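/- Let $M$ be a smooth (Hausdorff, second countable) manifold of dimension $n$ without boundary, let $S\to M$ be a smooth complex vector bundle of finite rank with a smooth Hermitian metric, and let $\mu$ be a nowhere-vanishing smooth measure on $M$, i.e. a Borel measure which in every chart $(U,\varphi)$ has the form $\mathrm d\varphi_*(\mu|_U)=f\,\mathrm d\lambda|_{\varphi(U)}$ with $f\colon\varphi(U)\to(0,\infty)$ smooth and $\lambda$ the Lebesgue measure. Let $L^2(M;S)$ be the completion of the space $\Gamma_c^\infty(M;S)$ of smooth compactly supported sections with respect to the inner product $\langle u,v\rangle=\int_M\langle u(p),v(p)\rangle_{S_p}\,\mathrm d\mu(p)$, and for $K\subseteq M$ let $L^2(K;S)\subseteq L^2(M;S)$ be the closure of the subspace of those smooth sections whose compact support is contained in $K$. A (first order linear) differential operator on $S$ is a $\mathbb C$-linear map $D\colon\Gamma^\infty(M;S)\to\Gamma^\infty(M;S)$ such that (a) if $u,v$ agree on an open set, then so do $Du,Dv$; and (b) for every chart $\varphi\colon U\to\mathbb R^n$ and every smooth trivialization $\Psi\colon S|_U\to U\times\mathbb C^k$, with second component $\psi$, there are smooth matrix-valued functions $A^1,\dots,A^n,B$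 on $U$ with $$(Du)(p)=\sum_{j=1}^n\Psi^{-1}\bigl(p,A^j(p)\,\partial_j(\psi\circ u\circ\varphi^{-1})|_{\varphi(p)}\bigr)+\Psi^{-1}\bigl(p,B(p)\,\psi(u(p))\bigr)$$ for all $u\in\Gamma^\infty(M;S)$ and $p\in U$. Let $K\subseteq M$ be compact. Then there exist $\epsilon>0$ and bounded linear operators $F_t\colon L^2(K;S)\to L^2(M;S)$, $0<t<\epsilon$, such that 1. there is a constant $C$ with $\|F_t\|\le C$ for all $t\in(0,\epsilon)$; 2. for every $u\in L^2(K;S)$, $\lim_{t\to0}F_tu=u$ in $L^2(M;S)$; 3. for every $t\in(0,\epsilon)$ and every $u\in L^2(K;S)$, $F_tu$ is a smooth section with compact support; 4. for every differential operator $D$ on $S$ there is a constant $C_D$ such that for every $t\in(0,\epsilon)$ the commutator $[D,F_t]u=D(F_tu)-F_t(Du)$, defined for smooth sections $u$ with compact support contained in $K$, extends to a bounded operator $L^2(K;S)\to L^2(M;S)$ of norm at most $C_D$. -/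

import Mathlib

open Set Filter Topology MeasureTheory Bundle
open scoped Manifold ContDiff ENNReal

set_option linter.unusedSectionVars false

noncomputable section

namespace HermitianBundle

section RealStructure

variable {M : Type*} [TopologicalSpace M]
  {F : Type*} [NormedAddCommGroup F] [NormedSpace ℂ F]
  {S : M → Type*} [TopologicalSpace (TotalSpace F S)]
  [∀ p, NormedAddCommGroup (S p)] [∀ p, InnerProductSpace ℂ (S p)]
  [FiberBundle F S]

theorem isLinear_real (e : Trivialization F (π F S)) (h : e.IsLinear ℂ) : e.IsLinear ℝ where
  linear b hb :=
    { map_add := (h.linear b hb).map_add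
      map_smul := fun c v => by
        have := (h.linear b hb).map_smul (c : ℂ) v
        simpa using this }

/-- A complex vector bundle is in particular a real vector bundle. -/
instance vectorBundle_real [h : VectorBundle ℂ F S] : VectorBundle ℝ F S where
  trivialization_linear' e _ := isLinear_real e (h.trivialization_linear' e)
  continuousOn_coordChange' e e' _ _ := by
    have : e.IsLinear ℝ := isLinear_real e (h.trivialization_linear' e)
    have : e'.IsLinear ℝ := isLinear_real e' (h.trivialization_linear' e')
    have h1 := h.continuousOn_coordChange' e e'
    have h2 : Continuous (fun A : F →L[ℂ] F => A.restrictScalars ℝ) :=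
      (ContinuousLinearMap.restrictScalarsL ℂ F F ℝ ℝ).continuous
    refine (h2.comp_continuousOn h1).congr ?_
    intro b hb
    ext v
    simp [Trivialization.coordChangeL_apply _ _ hb]

end RealStructure

section Sections

/-! The base `M` is a smooth manifold of dimension `n` without boundary, `S` is a complex vector
bundle over `M` with model fibre `F` (so that the rank is the dimension of `F`). -/

variable (n : ℕ) {M : Type*} [TopologicalSpace M] [ChartedSpace (EuclideanSpace ℝ (Fin n)) M]
  (F : Type*) [NormedAddCommGroup F] [NormedSpace ℂ F]
  (S : M → Type*) [TopologicalSpace (TotalSpace F S)]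
  [∀ p, NormedAddCommGroup (S p)] [∀ p, InnerProductSpace ℂ (S p)]
  [FiberBundle F S]

/-- Smoothness of a section. -/
def IsSmoothSection (u : ∀ p, S p) : Prop :=
  ContMDiff (𝓡 n) ((𝓡 n).prod 𝓘(ℝ, F)) ∞ (fun p => TotalSpace.mk' F p (u p))

/-- The support of a section. -/
def sectionSupport {S : M → Type*} [∀ p, NormedAddCommGroup (S p)] (u : ∀ p, S p) : Set M :=
  closure {p | u p ≠ 0}

theorem sectionSupport_add_subset (u v : ∀ p, S p) :
    sectionSupport (u + v) ⊆ sectionSupport u ∪ sectionSupport v := by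
  unfold sectionSupport
  rw [← closure_union]
  refine closure_mono fun p hp => ?_
  by_contra hcon
  simp only [mem_union, mem_ofPred_eq, not_or, not_not] at hcon
  exact hp (by simp [hcon.1, hcon.2])

theorem sectionSupport_smul_subset (c : ℂ) (u : ∀ p, S p) :
    sectionSupport (c • u) ⊆ sectionSupport u := by
  refine closure_mono fun p hp hcon => hp ?_
  simp [hcon]

theorem sectionSupport_zero : sectionSupport (0 : ∀ p, S p) = ∅ := by
  simp [sectionSupport]

/-- The inner products on the fibres vary smoothly. -/
class IsHermitian : Prop where
  contMDiff_inner : ∀ u v : ∀ p, S p, IsSmoothSection n F S u → IsSmoothSection n F S v →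
    ContMDiff (𝓡 n) 𝓘(ℝ, ℂ) ∞ (fun p => inner ℂ (u p) (v p))

variable [VectorBundle ℂ F S]

/-- The space of smooth sections of `S`. -/
def smoothSections : Submodule ℂ (∀ p, S p) where
  carrier := {u | IsSmoothSection n F S u}
  add_mem' := fun {u v} hu hv => ContMDiff.add_section hu hv
  zero_mem' := contMDiff_zeroSection ℝ S
  smul_mem' := fun c u hu p => by
    have hu' := hu p
    rw [contMDiffAt_section] at hu' ⊢
    set e := trivializationAt F S p
    have hc : ContMDiff 𝓘(ℝ, F) 𝓘(ℝ, F) ∞ (fun w : F => c • w) :=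
      (contDiff_const_smul c).contMDiff
    refine (hc.contMDiffAt.comp p hu').congr_of_eventuallyEq ?_
    refine eventually_of_mem
      (e.open_baseSet.mem_nhds (FiberBundle.mem_baseSet_trivializationAt F S p)) fun x hx => ?_
    exact (e.linear ℂ hx).map_smul c (u x)

/-- The space of smooth sections of `S` with compact support. -/
def testSections : Submodule ℂ (∀ p, S p) where
  carrier := {u | u ∈ smoothSections n F S ∧ IsCompact (sectionSupport u)}
  add_mem' := fun {u v} hu hv => ⟨add_mem hu.1 hv.1,
    (hu.2.union hv.2).of_isClosed_subset isClosed_closure (sectionSupport_add_subset S u v)⟩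
  zero_mem' := ⟨zero_mem _, by rw [sectionSupport_zero]; exact isCompact_empty⟩
  smul_mem' := fun c u hu => ⟨Submodule.smul_mem _ c hu.1,
    hu.2.of_isClosed_subset isClosed_closure (sectionSupport_smul_subset S c u)⟩

/-! ### Differential operators -/

variable {F S} in
/-- A local trivialization of the smooth complex vector bundle `S`: it is linear on the fibres and
a diffeomorphism onto its image. -/
structure IsSmoothTrivialization (Ψ : Trivialization F (π F S)) : Prop where
  isLinear : Ψ.IsLinear ℂ
  contMDiffOn : ContMDiffOn ((𝓡 n).prod 𝓘(ℝ, F)) ((𝓡 n).prod 𝓘(ℝ, F)) ∞ Ψ Ψ.source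
  contMDiffOn_symm : ContMDiffOn ((𝓡 n).prod 𝓘(ℝ, F)) ((𝓡 n).prod 𝓘(ℝ, F)) ∞
    Ψ.toOpenPartialHomeomorph.symm Ψ.target

variable {n F S} in
/-- First order linear differential operators acting on the sections of `S`. With a chart `φ` and
a trivialization `Ψ` of `S` over the domain of `φ`, the fibre coordinate of a section `u` in the
chart is `x ↦ (Ψ (u (φ.symm x))).2`. The coefficients, matrices of size the rank of `S`, are
written as linear endomorphisms of the model fibre. -/
structure IsDifferentialOperator (D : smoothSections n F S →ₗ[ℂ] smoothSections n F S) : Prop where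
  isLocal : ∀ (U : Set M), IsOpen U → ∀ u v : smoothSections n F S,
    (∀ p ∈ U, u.1 p = v.1 p) → ∀ p ∈ U, (D u).1 p = (D v).1 p
  eq_in_chart : ∀ φ ∈ IsManifold.maximalAtlas (𝓡 n) ∞ M, ∀ Ψ : Trivialization F (π F S),
    IsSmoothTrivialization n Ψ → φ.source ⊆ Ψ.baseSet →
    ∃ (A : Fin n → M → F →L[ℂ] F) (B : M → F →L[ℂ] F),
      (∀ j, ContMDiffOn (𝓡 n) 𝓘(ℝ, F →L[ℂ] F) ∞ (A j) φ.source) ∧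
      ContMDiffOn (𝓡 n) 𝓘(ℝ, F →L[ℂ] F) ∞ B φ.source ∧
      ∀ (u : smoothSections n F S), ∀ p ∈ φ.source,
        (D u).1 p =
          ∑ j : Fin n, Ψ.symm p (A j p
            (fderiv ℝ (fun x => (Ψ (TotalSpace.mk' F (φ.symm x) (u.1 (φ.symm x)))).2) (φ p)
              (EuclideanSpace.single j 1)))
          + Ψ.symm p (B p (Ψ (TotalSpace.mk' F p (u.1 p))).2)

variable {n F S} in
theorem IsDifferentialOperator.sectionSupport_subset
    {D : smoothSections n F S →ₗ[ℂ] smoothSections n F S} (hD : IsDifferentialOperator D)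
    (u : smoothSections n F S) : sectionSupport (D u).1 ⊆ sectionSupport u.1 := by
  refine closure_minimal (fun p hp => ?_) isClosed_closure
  by_contra hcon
  refine hp ?_
  have := hD.isLocal (sectionSupport u.1)ᶜ isClosed_closure.isOpen_compl u 0
    (fun q hq => by
      by_contra h
      exact hq (subset_closure h)) p hcon
  simpa using this

/-! ### Smooth measures and square integrable sections -/

variable [MeasurableSpace M]

/-- Nowhere-vanishing smooth measures: in every chart, the measure has a smooth and strictly
positive density with respect to Lebesgue measure. -/
class IsSmoothMeasure (μ : Measure M) : Prop where
  exists_density : ∀ φ ∈ IsManifold.maximalAtlas (𝓡 n) ∞ M,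
    ∃ f : EuclideanSpace ℝ (Fin n) → ℝ,
      ContDiffOn ℝ ∞ f φ.target ∧ (∀ x ∈ φ.target, 0 < f x) ∧
      (μ.restrict φ.source).map φ =
        (volume.restrict φ.target).withDensity (fun x => ENNReal.ofReal (f x))

end Sections

section SmoothMeasure

variable {n : ℕ} {M : Type*} [TopologicalSpace M] [ChartedSpace (EuclideanSpace ℝ (Fin n)) M]
  [MeasurableSpace M] [BorelSpace M]

theorem IsSmoothMeasure.exists_measure_eq [IsManifold (𝓡 n) ∞ M] (μ : Measure M)
    [hμ : IsSmoothMeasure n μ] (p : M) :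
    ∃ f : EuclideanSpace ℝ (Fin n) → ℝ,
      ContinuousOn f (chartAt (EuclideanSpace ℝ (Fin n)) p).target ∧
      (∀ x ∈ (chartAt (EuclideanSpace ℝ (Fin n)) p).target, 0 < f x) ∧
      ∀ V : Set (EuclideanSpace ℝ (Fin n)), IsOpen V →
        V ⊆ (chartAt (EuclideanSpace ℝ (Fin n)) p).target →
        μ ((chartAt (EuclideanSpace ℝ (Fin n)) p) ⁻¹' V ∩
          (chartAt (EuclideanSpace ℝ (Fin n)) p).source) = ∫⁻ x in V, ENNReal.ofReal (f x) := by
  set φ := chartAt (EuclideanSpace ℝ (Fin n)) p with hφ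
  obtain ⟨f, hf, hpos, hmap⟩ := hμ.exists_density φ (IsManifold.chart_mem_maximalAtlas p)
  refine ⟨f, hf.continuousOn, hpos, fun V hV hVt => ?_⟩
  have hae : AEMeasurable φ (μ.restrict φ.source) :=
    φ.continuousOn.aemeasurable φ.open_source.measurableSet
  have h1 := congrArg (fun ν => ν V) hmap
  rw [Measure.map_apply_of_aemeasurable hae hV.measurableSet,
    withDensity_apply _ hV.measurableSet, Measure.restrict_restrict hV.measurableSet,
    inter_eq_self_of_subset_left hVt, Measure.restrict_apply'  φ.open_source.measurableSet] at h1
  exact h1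

theorem IsSmoothMeasure.isLocallyFiniteMeasure [IsManifold (𝓡 n) ∞ M] (μ : Measure M)
    [hμ : IsSmoothMeasure n μ] : IsLocallyFiniteMeasure μ where
  finiteAtNhds p := by
    obtain ⟨f, hf, hpos, hV⟩ := IsSmoothMeasure.exists_measure_eq (n := n) μ p
    set φ := chartAt (EuclideanSpace ℝ (Fin n)) p with hφ
    have hp : p ∈ φ.source := mem_chart_source _ p
    have hx : φ p ∈ φ.target := φ.map_source hp
    set V := φ.target ∩ (f ⁻¹' Iio (f (φ p) + 1)) ∩ Metric.ball (φ p) 1 with hVdef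
    have hVo : IsOpen V :=
      (hf.isOpen_inter_preimage φ.open_target isOpen_Iio).inter Metric.isOpen_ball
    have hVx : φ p ∈ V := ⟨⟨hx, by simp⟩, by simp⟩
    refine ⟨φ.source ∩ φ ⁻¹' V, (φ.isOpen_inter_preimage hVo).mem_nhds ⟨hp, hVx⟩, ?_⟩
    rw [inter_comm, hV V hVo (fun x hx => hx.1.1)]
    calc ∫⁻ x in V, ENNReal.ofReal (f x)
        ≤ ∫⁻ _ in V, ENNReal.ofReal (f (φ p) + 1) := by
          refine setLIntegral_mono' hVo.measurableSet fun x hx => ?_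
          exact ENNReal.ofReal_le_ofReal (le_of_lt hx.1.2)
      _ = ENNReal.ofReal (f (φ p) + 1) * volume V := by simp
      _ < ⊤ := ENNReal.mul_lt_top ENNReal.ofReal_lt_top
          ((measure_mono inter_subset_right).trans_lt measure_ball_lt_top)

theorem IsSmoothMeasure.isOpenPosMeasure [IsManifold (𝓡 n) ∞ M] (μ : Measure M)
    [hμ : IsSmoothMeasure n μ] : μ.IsOpenPosMeasure where
  open_pos U hU hne := by
    obtain ⟨p, hpU⟩ := hne
    obtain ⟨f, hf, hpos, hV⟩ := IsSmoothMeasure.exists_measure_eq (n := n) μ p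
    set φ := chartAt (EuclideanSpace ℝ (Fin n)) p with hφ
    have hp : p ∈ φ.source := mem_chart_source _ p
    have hx : φ p ∈ φ.target := φ.map_source hp
    set V := (φ.target ∩ (f ⁻¹' Ioi (f (φ p) / 2))) ∩ (φ.target ∩ φ.symm ⁻¹' U) with hVdef
    have hVo : IsOpen V :=
      (hf.isOpen_inter_preimage φ.open_target isOpen_Ioi).inter (φ.symm.isOpen_inter_preimage hU)
    have hVx : φ p ∈ V := by
      refine ⟨⟨hx, ?_⟩, hx, ?_⟩
      · simpa using hpos _ hx
      · simpa [φ.left_inv hp] using hpU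
    have hsub : φ ⁻¹' V ∩ φ.source ⊆ U := by
      rintro q ⟨hq, hqs⟩
      have := hq.2.2
      simpa [φ.left_inv hqs] using this
    have hlow : ENNReal.ofReal (f (φ p) / 2) * volume V ≤ μ U := by
      calc ENNReal.ofReal (f (φ p) / 2) * volume V
          = ∫⁻ _ in V, ENNReal.ofReal (f (φ p) / 2) := by simp
        _ ≤ ∫⁻ x in V, ENNReal.ofReal (f x) := by
          refine setLIntegral_mono' hVo.measurableSet fun x hx => ?_
          exact ENNReal.ofReal_le_ofReal (le_of_lt hx.1.2)
        _ = μ (φ ⁻¹' V ∩ φ.source) := (hV V hVo (fun x hx => hx.1.1)).symm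
        _ ≤ μ U := measure_mono hsub
    have hVpos : 0 < volume V := hVo.measure_pos volume ⟨_, hVx⟩
    have : 0 < ENNReal.ofReal (f (φ p) / 2) * volume V :=
      ENNReal.mul_pos (by simpa using hpos _ hx) hVpos.ne'
    exact (this.trans_le hlow).ne'

end SmoothMeasure

section L2

variable (n : ℕ) {M : Type*} [TopologicalSpace M] [ChartedSpace (EuclideanSpace ℝ (Fin n)) M]
  [MeasurableSpace M]
  (F : Type*) [NormedAddCommGroup F] [NormedSpace ℂ F]
  (S : M → Type*) [TopologicalSpace (TotalSpace F S)]
  [∀ p, NormedAddCommGroup (S p)] [∀ p, InnerProductSpace ℂ (S p)]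
  [FiberBundle F S] [VectorBundle ℂ F S] (μ : Measure M)

/-- The space of smooth compactly supported sections, regarded as an inner product space for the
`L²` inner product defined by `μ`. -/
def TestSections (_μ : Measure M) : Type _ := testSections n F S

instance : AddCommGroup (TestSections n F S μ) :=
  inferInstanceAs (AddCommGroup (testSections n F S))

instance : Module ℂ (TestSections n F S μ) :=
  inferInstanceAs (Module ℂ (testSections n F S))

theorem continuous_inner_section [IsHermitian n F S] (u v : TestSections n F S μ) :
    Continuous (fun p => inner ℂ (u.1 p) (v.1 p)) :=
  (IsHermitian.contMDiff_inner (n := n) (F := F) u.1 v.1 u.2.1 v.2.1).continuous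

theorem hasCompactSupport_inner_section (u v : TestSections n F S μ) :
    HasCompactSupport (fun p => inner ℂ (u.1 p) (v.1 p)) := by
  refine u.2.2.of_isClosed_subset isClosed_closure (closure_mono fun p hp hcon => hp ?_)
  simp [hcon]

variable [BorelSpace M] [IsManifold (𝓡 n) ∞ M] [IsHermitian n F S] [IsSmoothMeasure n μ]

theorem integrable_inner_section (u v : TestSections n F S μ) :
    Integrable (fun p => inner ℂ (u.1 p) (v.1 p)) μ := by
  have := IsSmoothMeasure.isLocallyFiniteMeasure (n := n) μ
  exact (continuous_inner_section n F S μ u v).integrable_of_hasCompactSupport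
    (hasCompactSupport_inner_section n F S μ u v)

/-- The inner product `⟨u, v⟩ = ∫ ⟨u p, v p⟩ dμ(p)` of smooth compactly supported sections. -/
abbrev testSectionsCore : InnerProductSpace.Core ℂ (TestSections n F S μ) where
  inner u v := ∫ p, inner ℂ (u.1 p) (v.1 p) ∂μ
  conj_inner_symm u v := by
    rw [← integral_conj]
    simp
  re_inner_nonneg u := by
    have h := integral_re (integrable_inner_section n F S μ u u)
    change 0 ≤ RCLike.re (∫ p, inner ℂ (u.1 p) (u.1 p) ∂μ)
    rw [← h]
    exact integral_nonneg fun p => inner_self_nonneg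
  add_left u v w := by
    rw [← integral_add (integrable_inner_section n F S μ u w)
      (integrable_inner_section n F S μ v w)]
    refine integral_congr_ae (.of_forall fun p => ?_)
    exact inner_add_left _ _ _
  smul_left u v c := by
    rw [← integral_const_mul]
    refine integral_congr_ae (.of_forall fun p => ?_)
    exact inner_smul_left _ _ _
  definite u hu := by
    have := IsSmoothMeasure.isLocallyFiniteMeasure (n := n) μ
    have := IsSmoothMeasure.isOpenPosMeasure (n := n) μ
    by_contra hne
    have hne' : ∃ p, u.1 p ≠ 0 := by
      by_contra hcon
      push Not at hcon
      exact hne (Subtype.ext (funext hcon))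
    obtain ⟨p, hp⟩ := hne'
    have hc : Continuous fun p => RCLike.re (inner ℂ (u.1 p) (u.1 p)) :=
      RCLike.continuous_re.comp (continuous_inner_section n F S μ u u)
    have hs : HasCompactSupport fun p => RCLike.re (inner ℂ (u.1 p) (u.1 p)) :=
      (hasCompactSupport_inner_section n F S μ u u).comp_left (g := RCLike.re) (by simp)
    have hpos := hc.integral_pos_of_hasCompactSupport_nonneg_nonzero (μ := μ) (x := p) hs
      (fun q => inner_self_nonneg) (by
        rw [inner_self_eq_norm_sq]
        exact pow_ne_zero 2 (norm_ne_zero_iff.mpr hp))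
    rw [integral_re (integrable_inner_section n F S μ u u)] at hpos
    change (∫ p, inner ℂ (u.1 p) (u.1 p) ∂μ) = 0 at hu
    rw [hu] at hpos
    simp at hpos

instance : NormedAddCommGroup (TestSections n F S μ) :=
  (testSectionsCore n F S μ).toNormedAddCommGroup

instance : InnerProductSpace ℂ (TestSections n F S μ) :=
  InnerProductSpace.ofCore (testSectionsCore n F S μ).toCore

/-- The Hilbert space `L²(M; S)` of square integrable sections: the completion of the space of
smooth compactly supported sections. -/
abbrev L2 : Type _ := UniformSpace.Completion (TestSections n F S μ)

/-- The inclusion of the smooth compactly supported sections in `L²(M; S)`. -/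
abbrev toL2 : TestSections n F S μ →ₗᵢ[ℂ] L2 n F S μ := UniformSpace.Completion.toComplₗᵢ

/-- The smooth sections with compact support contained in `K`. -/
def testSectionsOn (K : Set M) : Submodule ℂ (TestSections n F S μ) where
  carrier := {u | sectionSupport u.1 ⊆ K}
  add_mem' := fun {u v} hu hv => (sectionSupport_add_subset S u.1 v.1).trans (union_subset hu hv)
  zero_mem' := (sectionSupport_zero S).subset.trans (empty_subset K)
  smul_mem' := fun c u hu => (sectionSupport_smul_subset S c u.1).trans hu

/-- The Hilbert space `L²(K; S)`, realized as the closure in `L²(M; S)` of the space of smooth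
sections with compact support contained in `K`. -/
def L2On (K : Set M) : Submodule ℂ (L2 n F S μ) :=
  ((testSectionsOn n F S μ K).map (toL2 n F S μ).toLinearMap).topologicalClosure

/-- The inclusion in `L²(K; S)` of the smooth sections with compact support contained in `K`. -/
def toL2On (K : Set M) (u : testSectionsOn n F S μ K) : L2On n F S μ K :=
  ⟨toL2 n F S μ u.1, Submodule.le_topologicalClosure _ (Submodule.mem_map_of_mem u.2)⟩

variable {n F S}

/-- The action of a differential operator on the smooth compactly supported sections. -/
def IsDifferentialOperator.onTest {D : smoothSections n F S →ₗ[ℂ] smoothSections n F S}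
    (hD : IsDifferentialOperator D) (u : TestSections n F S μ) : TestSections n F S μ :=
  ⟨(D ⟨u.1, u.2.1⟩).1, (D ⟨u.1, u.2.1⟩).2,
    u.2.2.of_isClosed_subset isClosed_closure (hD.sectionSupport_subset ⟨u.1, u.2.1⟩)⟩

/-- A differential operator preserves the sections which are supported in `K`. -/
def IsDifferentialOperator.onTestOn {D : smoothSections n F S →ₗ[ℂ] smoothSections n F S}
    (hD : IsDifferentialOperator D) (K : Set M) (u : testSectionsOn n F S μ K) :
    testSectionsOn n F S μ K :=
  ⟨hD.onTest μ u.1, (hD.sectionSupport_subset ⟨u.1.1, u.1.2.1⟩).trans u.2⟩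

/-- The bounded operator `B : L²(K; S) → L²(M; S)` extends the commutator `[D, T] = D T - T D`,
which is defined on the smooth sections `u` with compact support contained in `K`: for each of
them `T u` is (the class of) a section `v` in the domain of `D`, that is, smooth with compact
support, and `B u = D v - T (D u)`. -/
def ExtendsCommutator {D : smoothSections n F S →ₗ[ℂ] smoothSections n F S}
    (hD : IsDifferentialOperator D) (K : Set M)
    (T B : L2On n F S μ K →L[ℂ] L2 n F S μ) : Prop :=
  ∀ u : testSectionsOn n F S μ K, ∃ v : TestSections n F S μ,
    toL2 n F S μ v = T (toL2On n F S μ K u) ∧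
    B (toL2On n F S μ K u) =
      toL2 n F S μ (hD.onTest μ v) - T (toL2On n F S μ K (hD.onTestOn μ K u))

end L2

end HermitianBundle

end

open HermitianBundle

/-! The operators are Friedrichs mollifiers. On Euclidean space let J_t g(x) = ∫ ρ(z) g(x - tz) dz,
with ρ a smooth bump of integral one. J_t smooths every locally integrable function. Being an
average of translates, it is bounded on L² uniformly in t (`eLpNorm_le_of_enorm_le_lintegral`), and
J_t h - h is O(t) in sup norm for h smooth with compact support.

The heart is the commutator with a first order term a ∂ₑ, namely ∫ ρ(z) (a(x) - a(x - tz)) ∂ₑh(x -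
tz) dz. Up to the factor -1/t, ∂ₑh(x - tz) is a derivative in z, so integration by parts moves it
onto ρ and a. The factor 1/t is absorbed by |a(x) - a(x - tz)| ≤ Lip(a) t |z|. No derivative of h
survives, and the result is bounded by an average of |h| with a constant independent of t
(`smul_mollify_commutator_eq`, `exists_enorm_commutator_le`).

On M, finitely many bundle charts cover K, with a partition of unity f_i = η_i χ_i. The operator F_t
is the sum over i of: take coordinates, multiply by χ_i, apply J_t, multiply by η_i, lift back to a
section. The inner cutoff makes the coordinates a function on all of Euclidean space, the outer one
makes the result a compactly supported section, and both contribute only order zero terms to the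
commutator. On compact parts of a chart the metric and the density are comparable to constant ones,
so the estimates transfer (`exists_norm_commutator_le`, `exists_mollifiers`).

The coordinate map extends by density to the completion. Since J_t accepts any L² function, F_t u is
smooth for every u. Convergence passes from smooth sections to all of them by the uniform bound, and
the commutator extends by density. Every estimate holds for all t > 0, so ε is arbitrary. -/

noncomputable section

/-! ### Mollification and Friedrichs' commutator estimate on Euclidean space. -/

namespace Friedrichs

open Convolution NNReal

variable {E : Type*} [NormedAddCommGroup E] [NormedSpace ℝ E] [FiniteDimensional ℝ E]
  [MeasureSpace E] [BorelSpace E] [(volume : Measure E).IsAddHaarMeasure]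
  {F : Type*} [NormedAddCommGroup F] [NormedSpace ℝ F]

/-- The convolution of `g` with the kernel `ρ` rescaled to size `t`. -/
def mollify (ρ : E → ℝ) (t : ℝ) (g : E → F) (x : E) : F := ∫ z, ρ z • g (x - t • z)

/-- The kernel `ρ` rescaled to size `t`. -/
def rescale (ρ : E → ℝ) (t : ℝ) (y : E) : ℝ := |(t⁻¹ ^ Module.finrank ℝ E)| * ρ (t⁻¹ • y)

theorem contDiff_rescale {ρ : E → ℝ} (hρ : ContDiff ℝ ∞ ρ) (t : ℝ) :
    ContDiff ℝ ∞ (rescale ρ t) :=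
  contDiff_const.mul (hρ.comp (contDiff_const_smul _))

theorem hasCompactSupport_rescale {ρ : E → ℝ} (hρ : HasCompactSupport ρ) {t : ℝ} (ht : 0 < t) :
    HasCompactSupport (rescale ρ t) :=
  (hρ.comp_homeomorph (Homeomorph.smulOfNeZero t⁻¹ (inv_ne_zero ht.ne'))).mul_left

/-- Substitute y = tz. The form with fixed kernel `ρ` suits bounds uniform in `t`; the convolution
form gives smoothness and differentiation. -/
theorem mollify_eq_convolution (ρ : E → ℝ) {t : ℝ} (ht : 0 < t) (g : E → F) :
    mollify ρ t g = rescale ρ t ⋆[ContinuousLinearMap.lsmul ℝ ℝ, volume] g := by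
  ext x
  have h := Measure.integral_comp_smul (volume : Measure E)
    (fun y => ρ (t⁻¹ • y) • g (x - y)) t
  simp only [smul_smul, inv_mul_cancel₀ ht.ne', one_smul] at h
  simp only [mollify, convolution, rescale, ContinuousLinearMap.lsmul_apply, h, mul_smul,
    inv_pow]
  rw [integral_smul]

theorem contDiff_mollify {ρ : E → ℝ} (hρ : ContDiff ℝ ∞ ρ) (hρc : HasCompactSupport ρ) {t : ℝ}
    (ht : 0 < t) {g : E → F} (hg : LocallyIntegrable g) : ContDiff ℝ ∞ (mollify ρ t g) := by
  rw [mollify_eq_convolution ρ ht]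
  exact (hasCompactSupport_rescale hρc ht).contDiff_convolution_left _ (contDiff_rescale hρ t) hg

theorem integrable_mollify {ρ : E → ℝ} (hρ : Continuous ρ) (hρc : HasCompactSupport ρ) {t : ℝ}
    (ht : 0 < t) {g : E → F} (hg : LocallyIntegrable g) (x : E) :
    Integrable fun z => ρ z • g (x - t • z) := by
  have hc : Continuous (rescale ρ t) := by unfold rescale; fun_prop
  have h := ((hasCompactSupport_rescale hρc ht).convolutionExists_left
    (ContinuousLinearMap.lsmul ℝ ℝ) hc hg x).integrable.comp_smul ht.ne'
  have h2 := h.smul (|(t⁻¹ ^ Module.finrank ℝ E)|)⁻¹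
  have h0 : |(t⁻¹ ^ Module.finrank ℝ E)| ≠ 0 := by positivity
  refine h2.congr (.of_forall fun z => ?_)
  simp only [ContinuousLinearMap.lsmul_apply, rescale, Pi.smul_apply, smul_smul,
    inv_mul_cancel₀ ht.ne', one_smul]
  rw [inv_mul_cancel_left₀ h0]

/-- This makes mollification well defined, pointwise, on classes in `Lp`. -/
theorem mollify_congr_ae (ρ : E → ℝ) {t : ℝ} (ht : 0 < t) {g g' : E → F} (h : g =ᵐ[volume] g') :
    mollify ρ t g = mollify ρ t g' := by
  rw [mollify_eq_convolution ρ ht, mollify_eq_convolution ρ ht]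
  exact convolution_congr _ (ae_eq_refl _) h

theorem mollify_add {ρ : E → ℝ} (hρ : Continuous ρ) (hρc : HasCompactSupport ρ) {t : ℝ}
    (ht : 0 < t) {g g' : E → F} (hg : LocallyIntegrable g) (hg' : LocallyIntegrable g') :
    mollify ρ t (g + g') = mollify ρ t g + mollify ρ t g' := by
  ext x
  simp only [mollify, Pi.add_apply, smul_add]
  exact integral_add (integrable_mollify hρ hρc ht hg x) (integrable_mollify hρ hρc ht hg' x)

theorem mollify_sub {ρ : E → ℝ} (hρ : Continuous ρ) (hρc : HasCompactSupport ρ) {t : ℝ}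
    (ht : 0 < t) {g g' : E → F} (hg : LocallyIntegrable g) (hg' : LocallyIntegrable g') :
    mollify ρ t (g - g') = mollify ρ t g - mollify ρ t g' := by
  ext x
  simp only [mollify, Pi.sub_apply, smul_sub]
  exact integral_sub (integrable_mollify hρ hρc ht hg x) (integrable_mollify hρ hρc ht hg' x)

theorem mollify_sum {ι : Type*} (s : Finset ι) {ρ : E → ℝ} (hρ : Continuous ρ)
    (hρc : HasCompactSupport ρ) {t : ℝ} (ht : 0 < t) {g : ι → E → F}
    (hg : ∀ i ∈ s, LocallyIntegrable (g i)) (x : E) :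
    mollify ρ t (fun y => ∑ i ∈ s, g i y) x = ∑ i ∈ s, mollify ρ t (g i) x := by
  simp only [mollify, Finset.smul_sum]
  exact integral_finsetSum s fun i hi => integrable_mollify hρ hρc ht (hg i hi) x

theorem mollify_smul {𝕜 : Type*} [NontriviallyNormedField 𝕜] [NormedSpace 𝕜 F]
    [SMulCommClass ℝ 𝕜 F] (ρ : E → ℝ) (t : ℝ) (c : 𝕜) (g : E → F) :
    mollify ρ t (c • g) = c • mollify ρ t g := by
  ext x
  simp only [mollify, Pi.smul_apply, smul_comm _ c]
  exact integral_smul c _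

theorem eLpNorm_two_eq {α G : Type*} [MeasurableSpace α] [NormedAddCommGroup G] (f : α → G)
    (ν : Measure α) : eLpNorm f 2 ν = (∫⁻ x, ‖f x‖ₑ ^ 2 ∂ν) ^ (1 / 2 : ℝ) := by
  rw [eLpNorm_eq_lintegral_rpow_enorm_toReal (by simp) (by simp)]
  simp

/-- An `L²` function averaged over the translations by a bounded set is `L²`. -/
theorem eLpNorm_le_of_enorm_le_lintegral {G : Type*} [NormedAddCommGroup G] {t : ℝ}
    {v : E → F} (hv : StronglyMeasurable v) {B : Set E}
    {w : E → G} {c : ℝ≥0∞} (hw : ∀ x, ‖w x‖ₑ ≤ c * ∫⁻ z in B, ‖v (x - t • z)‖ₑ) :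
    eLpNorm w 2 volume ≤ c * volume B * eLpNorm v 2 volume := by
  have hmeas : Measurable fun p : E × E => ‖v (p.1 - t • p.2)‖ₑ :=
    (hv.comp_measurable (by fun_prop : Measurable fun p : E × E => p.1 - t • p.2)).enorm
  -- Cauchy–Schwarz on `B`.
  have key : ∀ x, ‖w x‖ₑ ^ 2 ≤ c ^ 2 * (volume B * ∫⁻ z in B, ‖v (x - t • z)‖ₑ ^ 2) := by
    intro x
    have hm : AEStronglyMeasurable (fun z => v (x - t • z)) (volume.restrict B) :=
      (hv.comp_measurable (by fun_prop : Measurable fun z : E => x - t • z)).aestronglyMeasurable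
    have h := eLpNorm_le_eLpNorm_mul_rpow_measure_univ (p := 1) (q := 2) (by simp) hm
    rw [eLpNorm_one_eq_lintegral_enorm, eLpNorm_two_eq, Measure.restrict_apply_univ] at h
    calc ‖w x‖ₑ ^ 2 ≤ (c * ((∫⁻ z in B, ‖v (x - t • z)‖ₑ ^ 2) ^ (1 / 2 : ℝ)
          * volume B ^ (1 / 2 : ℝ))) ^ 2 := by
          gcongr
          refine (hw x).trans ?_
          gcongr
          refine h.trans (le_of_eq ?_)
          congr 2
          norm_num
      _ = _ := by
          rw [mul_pow, mul_pow, ← ENNReal.rpow_natCast (_ ^ (1 / 2 : ℝ)),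
            ← ENNReal.rpow_natCast (volume B ^ (1 / 2 : ℝ)), ← ENNReal.rpow_mul,
            ← ENNReal.rpow_mul]
          norm_num
          ring
  -- Tonelli, then translation invariance in `x` for each fixed `z`; this is why `t` leaves no
  -- trace.
  have total : ∫⁻ x, ‖w x‖ₑ ^ 2 ≤ (c * volume B) ^ 2 * ∫⁻ x, ‖v x‖ₑ ^ 2 := by
    calc ∫⁻ x, ‖w x‖ₑ ^ 2
        ≤ ∫⁻ x, c ^ 2 * (volume B * ∫⁻ z in B, ‖v (x - t • z)‖ₑ ^ 2) := lintegral_mono key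
      _ = c ^ 2 * volume B * ∫⁻ x, ∫⁻ z in B, ‖v (x - t • z)‖ₑ ^ 2 := by
          have hi : Measurable fun x => ∫⁻ z in B, ‖v (x - t • z)‖ₑ ^ 2 :=
            (hmeas.pow_const 2).lintegral_prod_right'
          rw [lintegral_const_mul _ (hi.const_mul _), lintegral_const_mul _ hi, mul_assoc]
      _ = c ^ 2 * volume B * ∫⁻ z in B, ∫⁻ x, ‖v (x - t • z)‖ₑ ^ 2 := by
          rw [lintegral_lintegral_swap]
          exact (hmeas.pow_const 2).aemeasurable
      _ = c ^ 2 * volume B * ∫⁻ z in B, ∫⁻ x, ‖v x‖ₑ ^ 2 := by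
          congr 1
          refine lintegral_congr fun z => ?_
          exact lintegral_sub_right_eq_self (fun x => ‖v x‖ₑ ^ 2) (t • z)
      _ = _ := by
          rw [setLIntegral_const]
          ring
  rw [eLpNorm_two_eq, eLpNorm_two_eq]
  calc (∫⁻ x, ‖w x‖ₑ ^ 2) ^ (1 / 2 : ℝ)
      ≤ ((c * volume B) ^ 2 * ∫⁻ x, ‖v x‖ₑ ^ 2) ^ (1 / 2 : ℝ) := by gcongr
    _ = _ := by
      rw [ENNReal.mul_rpow_of_nonneg _ _ (by norm_num), ← ENNReal.rpow_natCast,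
        ← ENNReal.rpow_mul]
      norm_num

theorem exists_nnnorm_le {G : Type*} [NormedAddCommGroup G] {f : E → G} (hf : Continuous f)
    (hfc : HasCompactSupport f) : ∃ C : ℝ≥0, ∀ x, ‖f x‖₊ ≤ C := by
  obtain ⟨C, hC⟩ := hfc.exists_bound_of_continuous hf
  exact ⟨C.toNNReal, fun x => NNReal.le_toNNReal_of_coe_le (hC x)⟩

theorem fderiv_mollify_apply {ρ : E → ℝ} (hρ : ContDiff ℝ ∞ ρ) (hρc : HasCompactSupport ρ) {t : ℝ}
    (ht : 0 < t) {h : E → F} (hh : ContDiff ℝ ∞ h) (hhc : HasCompactSupport h) (x e : E) :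
    fderiv ℝ (mollify ρ t h) x e = mollify ρ t (fun y => fderiv ℝ h y e) x := by
  have hr := contDiff_rescale hρ t
  have hd := hhc.hasFDerivAt_convolution_right (ContinuousLinearMap.lsmul ℝ ℝ)
    (hr.continuous.locallyIntegrable (μ := volume)) (hh.of_le (by exact_mod_cast le_top)) x
  have hex := ((hasCompactSupport_rescale hρc ht).convolutionExists_left
    ((ContinuousLinearMap.lsmul ℝ ℝ).precompR E) hr.continuous
    ((hh.continuous_fderiv (by simp)).locallyIntegrable (μ := volume)) x).integrable
  rw [mollify_eq_convolution ρ ht, mollify_eq_convolution ρ ht, hd.fderiv, convolution,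
    ContinuousLinearMap.integral_apply hex]
  rfl

/-- Friedrichs' identity: the commutator of the mollification with `a ∂ₑ` after integration by
parts. -/
theorem smul_mollify_commutator_eq [CompleteSpace F] {ρ : E → ℝ} (hρ : ContDiff ℝ ∞ ρ) (hρc : HasCompactSupport ρ)
    (t : ℝ) {a : E → F →L[ℝ] F} (ha : ContDiff ℝ ∞ a) {h : E → F}
    (hh : ContDiff ℝ ∞ h) (x e : E) :
    t • (a x (mollify ρ t (fun y => fderiv ℝ h y e) x)
        - mollify ρ t (fun y => a y (fderiv ℝ h y e)) x) =
      (∫ z, fderiv ℝ ρ z e • (a x - a (x - t • z)) (h (x - t • z)))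
        + t • mollify ρ t (fun y => (fderiv ℝ a y e) (h y)) x := by
  have hda : ∀ y, HasFDerivAt a (fderiv ℝ a y) y := fun y =>
    (ha.differentiable (by simp) y).hasFDerivAt
  have hdh : ∀ y, HasFDerivAt h (fderiv ℝ h y) y := fun y =>
    (hh.differentiable (by simp) y).hasFDerivAt
  have hca := ha.continuous
  have hch := hh.continuous
  have hcρ := hρ.continuous
  have hcda := ha.continuous_fderiv (by simp)
  have hcdh := hh.continuous_fderiv (by simp)
  have hcdρ := hρ.continuous_fderiv (by simp)
  -- The `z`-derivative of `g` along `e` is `-t` times the integrand of the commutator (without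
  -- `ρ`), plus `t` times a term without derivatives of `h`. Integrating it by parts against `ρ`
  -- gives the identity.
  set g : E → F := fun z => (a x - a (x - t • z)) (h (x - t • z)) with hg
  have hin : ∀ z : E, HasFDerivAt (fun z : E => x - t • z) (-(t • ContinuousLinearMap.id ℝ E)) z :=
    fun z => ((hasFDerivAt_id z).const_smul t).const_sub x
  have hgd : ∀ z, HasFDerivAt g ((a x - a (x - t • z)) ∘L
        (fderiv ℝ h (x - t • z) ∘L (-(t • ContinuousLinearMap.id ℝ E)))
      + (-(fderiv ℝ a (x - t • z) ∘L (-(t • ContinuousLinearMap.id ℝ E)))).flip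
        (h (x - t • z))) z := fun z =>
    (((hda _).comp z (hin z)).const_sub (a x)).clm_apply ((hdh _).comp z (hin z))
  have hgd' : ∀ z, fderiv ℝ g z e = t • (fderiv ℝ a (x - t • z) e) (h (x - t • z))
      - t • (a x - a (x - t • z)) (fderiv ℝ h (x - t • z) e) := by
    intro z
    rw [(hgd z).fderiv]
    simp
    abel
  have hcg : Continuous g := by fun_prop
  have hcgd : Continuous fun z => fderiv ℝ g z e := by
    simp only [hgd']
    fun_prop
  have ibp : ∫ z, ρ z • fderiv ℝ g z e = -∫ z, fderiv ℝ ρ z e • g z := by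
    refine integral_smul_fderiv_eq_neg_fderiv_smul_of_integrable ?_ ?_ ?_
      (fun z _ => hρ.differentiable (by simp) z) (fun z _ => (hgd z).differentiableAt)
    · refine Continuous.integrable_of_hasCompactSupport (by fun_prop) ?_
      exact ((hρc.fderiv_apply ℝ e)).smul_right
    · exact Continuous.integrable_of_hasCompactSupport (by fun_prop) hρc.smul_right
    · exact Continuous.integrable_of_hasCompactSupport (by fun_prop) hρc.smul_right
  have hi1 : Integrable fun z => ρ z • (fderiv ℝ a (x - t • z) e) (h (x - t • z)) :=
    Continuous.integrable_of_hasCompactSupport (by fun_prop) hρc.smul_right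
  have hi2 : Integrable fun z => ρ z • a x (fderiv ℝ h (x - t • z) e) :=
    Continuous.integrable_of_hasCompactSupport (by fun_prop) hρc.smul_right
  have hi3 : Integrable fun z => ρ z • a (x - t • z) (fderiv ℝ h (x - t • z) e) :=
    Continuous.integrable_of_hasCompactSupport (by fun_prop) hρc.smul_right
  have hi4 : Integrable fun z => ρ z • fderiv ℝ h (x - t • z) e :=
    Continuous.integrable_of_hasCompactSupport (by fun_prop) hρc.smul_right
  have e1 : ∫ z, ρ z • fderiv ℝ g z e =
      t • mollify ρ t (fun y => (fderiv ℝ a y e) (h y)) x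
        - t • ((∫ z, ρ z • a x (fderiv ℝ h (x - t • z) e))
          - mollify ρ t (fun y => a y (fderiv ℝ h y e)) x) := by
    simp only [mollify]
    rw [← integral_sub hi2 hi3, ← integral_smul, ← integral_smul, ← integral_sub]
    · refine integral_congr_ae (.of_forall fun z => ?_)
      simp only [hgd', smul_sub, _root_.sub_apply, smul_comm (ρ z) t]
    · exact hi1.smul t
    · exact (hi2.sub hi3).smul t
  have e2 : a x (mollify ρ t (fun y => fderiv ℝ h y e) x) =
      ∫ z, ρ z • a x (fderiv ℝ h (x - t • z) e) := by
    rw [mollify, ← ContinuousLinearMap.integral_comp_comm _ hi4]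
    simp only [map_smul]
  rw [e2]
  have := ibp.symm.trans e1
  rw [← neg_eq_iff_eq_neg.2 this.symm]
  abel

theorem nnnorm_clm_apply_le (A : F →L[ℝ] F) {C : ℝ≥0} (hA : ‖A‖₊ ≤ C) (w : F) :
    ‖A w‖₊ ≤ C * ‖w‖₊ :=
  A.le_of_opNorm_le hA w

/-- The average of `‖v‖` over the support of the kernel `ρ` rescaled to size `t`. -/
def average (ρ : E → ℝ) (t : ℝ) (v : E → F) (x : E) : ℝ≥0∞ :=
  ∫⁻ z in tsupport ρ, ‖v (x - t • z)‖ₑ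

theorem enorm_le_of_nnnorm_le {G G' : Type*} [NormedAddCommGroup G] [NormedAddCommGroup G']
    {x : G} {y : G'} {C : ℝ≥0} (h : ‖x‖₊ ≤ C * ‖y‖₊) : ‖x‖ₑ ≤ C * ‖y‖ₑ := by
  simp only [enorm_eq_nnnorm]
  exact_mod_cast h

/-- Every error term below is brought to this form, so that a single `L²` bound for averages handles
them all. -/
theorem enorm_integral_le_average {G : Type*} [NormedAddCommGroup G] [NormedSpace ℝ G]
    {ρ : E → ℝ} {t : ℝ} {v : E → F} {x : E} {k : E → G} {C : ℝ≥0}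
    (hk : ∀ z, z ∉ tsupport ρ → k z = 0)
    (hC : ∀ z ∈ tsupport ρ, ‖k z‖₊ ≤ C * ‖v (x - t • z)‖₊) :
    ‖∫ z, k z‖ₑ ≤ C * average ρ t v x := by
  rw [← setIntegral_eq_integral_of_forall_compl_eq_zero hk]
  refine (enorm_integral_le_lintegral_enorm _).trans ?_
  rw [average, ← lintegral_const_mul' _ _ ENNReal.coe_ne_top]
  exact setLIntegral_mono' (isClosed_tsupport ρ).measurableSet
    fun z hz => enorm_le_of_nnnorm_le (hC z hz)

theorem enorm_mollify_le_average {G : Type*} [NormedAddCommGroup G] [NormedSpace ℝ G]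
    {ρ : E → ℝ} {C M : ℝ≥0} (hC : ∀ z, ‖ρ z‖₊ ≤ C) (t : ℝ)
    {g : E → G} {v : E → F} (hg : ∀ y, ‖g y‖₊ ≤ M * ‖v y‖₊) (x : E) :
    ‖mollify ρ t g x‖ₑ ≤ (C * M : ℝ≥0) * average ρ t v x := by
  refine enorm_integral_le_average (fun z hz => ?_) fun z _ => ?_
  · rw [image_eq_zero_of_notMem_tsupport hz, zero_smul]
  · rw [nnnorm_smul, mul_assoc]
    gcongr
    exacts [hC z, hg _]

/-- The constant is `C` times the volume of the support of `ρ`, chosen before `t`. -/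
theorem exists_eLpNorm_le_of_enorm_le_average {ρ : E → ℝ} (hρc : HasCompactSupport ρ) (C : ℝ≥0) :
    ∃ C' : ℝ≥0, ∀ (t : ℝ) (v w : E → F), StronglyMeasurable v →
      (∀ x, ‖w x‖ₑ ≤ C * average ρ t v x) → eLpNorm w 2 volume ≤ C' * eLpNorm v 2 volume := by
  have hB : volume (tsupport ρ) ≠ ⊤ := hρc.isCompact.measure_lt_top.ne
  refine ⟨C * (volume (tsupport ρ)).toNNReal, fun t v w hv hw => ?_⟩
  rw [ENNReal.coe_mul, ENNReal.coe_toNNReal hB]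
  exact eLpNorm_le_of_enorm_le_lintegral hv hw

theorem exists_eLpNorm_mollify_le {ρ : E → ℝ} (hρ : Continuous ρ) (hρc : HasCompactSupport ρ) :
    ∃ C : ℝ≥0, ∀ (t : ℝ) (v : E → F), StronglyMeasurable v →
      eLpNorm (mollify ρ t v) 2 volume ≤ C * eLpNorm v 2 volume := by
  obtain ⟨C, hC⟩ := exists_nnnorm_le hρ hρc
  obtain ⟨C', hC'⟩ := exists_eLpNorm_le_of_enorm_le_average (F := F) hρc (C * 1)
  exact ⟨C', fun t v hv => hC' t v _ hv
    (enorm_mollify_le_average hC t fun y => (one_mul _).ge)⟩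

/-- **Friedrichs' lemma**: the commutator of the mollification with `a ∂ₑ` is an operator of
order zero, uniformly in the scale. The mollification is cut off by `χ` and `η`. -/
theorem exists_enorm_commutator_le [CompleteSpace F] {ρ : E → ℝ} (hρ : ContDiff ℝ ∞ ρ)
    (hρc : HasCompactSupport ρ) {a : E → F →L[ℝ] F} (ha : ContDiff ℝ ∞ a)
    (hac : HasCompactSupport a) {η χ : E → ℝ} (hη : ContDiff ℝ ∞ η) (hηc : HasCompactSupport η)
    (hχ : ContDiff ℝ ∞ χ) (hχc : HasCompactSupport χ) (e : E) :
    ∃ C : ℝ≥0, ∀ t : ℝ, 0 < t → ∀ v : E → F, ContDiff ℝ ∞ v → ∀ x,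
      ‖a x (fderiv ℝ (fun y => η y • mollify ρ t (fun y => χ y • v y) y) x e)
        - η x • mollify ρ t (fun y => χ y • a y (fderiv ℝ v y e)) x‖ₑ ≤
      C * average ρ t v x := by
  obtain ⟨R, hR⟩ := hρc.isCompact.isBounded.exists_norm_le
  obtain ⟨La, hLa⟩ := ha.lipschitzWith_of_hasCompactSupport hac (by simp)
  obtain ⟨Cρ, hCρ⟩ := exists_nnnorm_le hρ.continuous hρc
  obtain ⟨Ca, hCa⟩ := exists_nnnorm_le ha.continuous hac
  obtain ⟨Cη, hCη⟩ := exists_nnnorm_le hη.continuous hηc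
  obtain ⟨Cχ, hCχ⟩ := exists_nnnorm_le hχ.continuous hχc
  have hdρ : Continuous fun z => fderiv ℝ ρ z e :=
    (hρ.continuous_fderiv (by simp)).clm_apply continuous_const
  have hda : Continuous fun z => fderiv ℝ a z e :=
    (ha.continuous_fderiv (by simp)).clm_apply continuous_const
  have hdη : Continuous fun z => fderiv ℝ η z e :=
    (hη.continuous_fderiv (by simp)).clm_apply continuous_const
  have hdχ : Continuous fun z => fderiv ℝ χ z e :=
    (hχ.continuous_fderiv (by simp)).clm_apply continuous_const
  obtain ⟨Cρ', hCρ'⟩ := exists_nnnorm_le hdρ (hρc.fderiv_apply ℝ e)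
  obtain ⟨Ca', hCa'⟩ := exists_nnnorm_le hda (hac.fderiv_apply ℝ e)
  obtain ⟨Cη', hCη'⟩ := exists_nnnorm_le hdη (hηc.fderiv_apply ℝ e)
  obtain ⟨Cχ', hCχ'⟩ := exists_nnnorm_le hdχ (hχc.fderiv_apply ℝ e)
  -- The three summands bound the three terms of `main` below: derivative on `η`, Friedrichs
  -- commutator, derivative on `χ`.
  refine ⟨Cη' * Ca * (Cρ * Cχ) + Cη * (Cρ' * La * R.toNNReal * Cχ + Cρ * (Ca' * Cχ))
    + Cη * (Cρ * (Cχ' * Ca)), fun t ht v hv x => ?_⟩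
  set h : E → F := fun y => χ y • v y with hh
  have hhs : ContDiff ℝ ∞ h := hχ.smul hv
  have hhc : HasCompactSupport h := hχc.smul_right
  have hhv : ∀ y, ‖h y‖₊ ≤ Cχ * ‖v y‖₊ := fun y => by
    rw [hh, nnnorm_smul]
    gcongr
    exact hCχ y
  have hJs : ContDiff ℝ ∞ (mollify ρ t h) :=
    contDiff_mollify hρ hρc ht (hhs.continuous.locallyIntegrable)
  have hdh : ∀ y, fderiv ℝ h y e = χ y • fderiv ℝ v y e + fderiv ℝ χ y e • v y := by
    intro y
    rw [hh, fderiv_fun_smul (hχ.differentiable (by simp) y) (hv.differentiable (by simp) y)]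
    simp
  have hcdv : Continuous fun y => fderiv ℝ v y e :=
    (hv.continuous_fderiv (by simp)).clm_apply continuous_const
  have hcdh : Continuous fun y => fderiv ℝ h y e :=
    (hhs.continuous_fderiv (by simp)).clm_apply continuous_const
  have hca := ha.continuous
  have hcv := hv.continuous
  have hcχ := hχ.continuous
  -- With h = χv, Leibniz gives χ ∂ₑv = ∂ₑh - (∂ₑχ) v.
  have split : mollify ρ t (fun y => χ y • a y (fderiv ℝ v y e)) x =
      mollify ρ t (fun y => a y (fderiv ℝ h y e)) x
        - mollify ρ t (fun y => fderiv ℝ χ y e • a y (v y)) x := by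
    rw [← Pi.sub_apply, ← mollify_sub hρ.continuous hρc ht
      (Continuous.locallyIntegrable (by fun_prop)) (Continuous.locallyIntegrable (by fun_prop))]
    congr 1
    ext y
    simp [hdh]
  set κ := a x (mollify ρ t (fun y => fderiv ℝ h y e) x)
    - mollify ρ t (fun y => a y (fderiv ℝ h y e)) x with hκ
  have main : a x (fderiv ℝ (fun y => η y • mollify ρ t h y) x e)
        - η x • mollify ρ t (fun y => χ y • a y (fderiv ℝ v y e)) x =
      fderiv ℝ η x e • a x (mollify ρ t h x) + η x • κ
        + η x • mollify ρ t (fun y => fderiv ℝ χ y e • a y (v y)) x := by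
    rw [fderiv_fun_smul (hη.differentiable (by simp) x) (hJs.differentiable (by simp) x), split,
      hκ]
    simp [fderiv_mollify_apply hρ hρc ht hhs hhc, smul_sub]
    abel
  have b1 := enorm_mollify_le_average hCρ t hhv x
  have b3 := enorm_mollify_le_average (M := Cχ' * Ca) hCρ t
    (g := fun y => fderiv ℝ χ y e • a y (v y)) (v := v) (fun y => by
      rw [nnnorm_smul, mul_assoc]
      gcongr
      · exact hCχ' y
      · exact nnnorm_clm_apply_le (a y) (hCa y) _) x
  have b4 := enorm_mollify_le_average (M := Ca' * Cχ) hCρ t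
    (g := fun y => fderiv ℝ a y e (h y)) (v := v) (fun y => by
      refine (nnnorm_clm_apply_le (fderiv ℝ a y e) (hCa' y) _).trans ?_
      rw [mul_assoc]
      gcongr
      exact hhv y) x
  have b5 : ‖∫ z, fderiv ℝ ρ z e • (a x - a (x - t • z)) (h (x - t • z))‖ₑ ≤
      (t.toNNReal * (Cρ' * La * R.toNNReal * Cχ) : ℝ≥0) * average ρ t v x := by
    refine enorm_integral_le_average (fun z hz => ?_) fun z hz => ?_
    · have : fderiv ℝ ρ z = 0 := image_eq_zero_of_notMem_tsupport
        fun hz' => hz (tsupport_fderiv_subset ℝ hz')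
      simp [this]
    -- The Lipschitz bound on `a` supplies the factor `t` that compensates the integration by parts.
    · have h1 : ‖a x - a (x - t • z)‖₊ ≤ La * (t.toNNReal * R.toNNReal) := by
        refine (show _ ≤ La * ‖x - (x - t • z)‖₊ from hLa.norm_sub_le _ _).trans ?_
        rw [sub_sub_cancel, nnnorm_smul]
        gcongr
        · exact NNReal.le_toNNReal_of_coe_le (by simp [abs_of_pos ht])
        · exact NNReal.le_toNNReal_of_coe_le (hR z hz)
      rw [nnnorm_smul]
      calc _ ≤ Cρ' * ((La * (t.toNNReal * R.toNNReal)) * (Cχ * ‖v (x - t • z)‖₊)) := by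
            gcongr
            · exact hCρ' z
            · refine (nnnorm_clm_apply_le _ h1 _).trans ?_
              gcongr
              exact hhv _
        _ = _ := by ring
  have b2 : ‖κ‖ₑ ≤ (Cρ' * La * R.toNNReal * Cχ + Cρ * (Ca' * Cχ) : ℝ≥0) * average ρ t v x := by
    have hid := smul_mollify_commutator_eq hρ hρc t ha hhs x e
    rw [← hκ] at hid
    have ht0 : t.toNNReal ≠ 0 := (Real.toNNReal_pos.2 ht).ne'
    have het : ‖t‖ₑ = (t.toNNReal : ℝ≥0∞) := Real.enorm_of_nonneg ht.le
    -- Both terms of Friedrichs' identity carry a factor `t`, which then cancels.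
    have : (t.toNNReal : ℝ≥0∞) * ‖κ‖ₑ ≤ t.toNNReal *
        ((Cρ' * La * R.toNNReal * Cχ + Cρ * (Ca' * Cχ) : ℝ≥0) * average ρ t v x) := by
      rw [← het, ← enorm_smul, hid]
      have b6 := mul_le_mul_right b4 ‖t‖ₑ
      rw [← enorm_smul] at b6
      refine (enorm_add_le _ _).trans ((add_le_add b5 b6).trans (le_of_eq ?_))
      rw [het]
      push_cast
      ring
    exact (ENNReal.mul_le_mul_iff_right (by simpa using ht0) ENNReal.coe_ne_top).1 this
  rw [main]
  have c1 : ‖fderiv ℝ η x e‖ₑ ≤ Cη' := by exact_mod_cast ENNReal.coe_le_coe.2 (hCη' x)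
  have c2 : ‖η x‖ₑ ≤ Cη := by exact_mod_cast ENNReal.coe_le_coe.2 (hCη x)
  have c3 : ‖a x (mollify ρ t h x)‖ₑ ≤ Ca * ‖mollify ρ t h x‖ₑ :=
    enorm_le_of_nnnorm_le (nnnorm_clm_apply_le (a x) (hCa x) _)
  calc _ ≤ ‖fderiv ℝ η x e‖ₑ * ‖a x (mollify ρ t h x)‖ₑ + ‖η x‖ₑ * ‖κ‖ₑ
        + ‖η x‖ₑ * ‖mollify ρ t (fun y => fderiv ℝ χ y e • a y (v y)) x‖ₑ := by
        simp only [← enorm_smul]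
        exact (enorm_add_le _ _).trans (add_le_add (enorm_add_le _ _) le_rfl)
    _ ≤ Cη' * (Ca * ((Cρ * Cχ : ℝ≥0) * average ρ t v x))
        + Cη * ((Cρ' * La * R.toNNReal * Cχ + Cρ * (Ca' * Cχ) : ℝ≥0) * average ρ t v x)
        + Cη * ((Cρ * (Cχ' * Ca) : ℝ≥0) * average ρ t v x) := by
        gcongr
        exact c3.trans (by gcongr)
    _ = _ := by
        push_cast
        ring

/-- In order zero no cancellation is needed: each of the two terms is bounded by itself. -/
theorem exists_enorm_commutator_zero_le {ρ : E → ℝ} (hρ : ContDiff ℝ ∞ ρ)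
    (hρc : HasCompactSupport ρ) {b : E → F →L[ℝ] F} (hb : ContDiff ℝ ∞ b)
    (hbc : HasCompactSupport b) {η χ : E → ℝ} (hη : ContDiff ℝ ∞ η) (hηc : HasCompactSupport η)
    (hχ : ContDiff ℝ ∞ χ) (hχc : HasCompactSupport χ) :
    ∃ C : ℝ≥0, ∀ (t : ℝ) (v : E → F), ∀ x,
      ‖b x (η x • mollify ρ t (fun y => χ y • v y) x)
        - η x • mollify ρ t (fun y => χ y • b y (v y)) x‖ₑ ≤ C * average ρ t v x := by
  obtain ⟨Cρ, hCρ⟩ := exists_nnnorm_le hρ.continuous hρc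
  obtain ⟨Cb, hCb⟩ := exists_nnnorm_le hb.continuous hbc
  obtain ⟨Cη, hCη⟩ := exists_nnnorm_le hη.continuous hηc
  obtain ⟨Cχ, hCχ⟩ := exists_nnnorm_le hχ.continuous hχc
  refine ⟨Cb * Cη * (Cρ * Cχ) + Cη * (Cρ * (Cχ * Cb)), fun t v x => ?_⟩
  have b1 := enorm_mollify_le_average (M := Cχ) hCρ t (g := fun y => χ y • v y) (v := v)
    (fun y => by
      rw [nnnorm_smul]
      gcongr
      exact hCχ y) x
  have b2 := enorm_mollify_le_average (M := Cχ * Cb) hCρ t (g := fun y => χ y • b y (v y)) (v := v)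
    (fun y => by
      rw [nnnorm_smul, mul_assoc]
      gcongr
      · exact hCχ y
      · exact nnnorm_clm_apply_le (b y) (hCb y) _) x
  have c2 : ‖η x‖ₑ ≤ Cη := by exact_mod_cast ENNReal.coe_le_coe.2 (hCη x)
  have c3 : ∀ w, ‖b x w‖ₑ ≤ Cb * ‖w‖ₑ := fun w =>
    enorm_le_of_nnnorm_le (nnnorm_clm_apply_le (b x) (hCb x) _)
  refine (enorm_sub_le).trans ?_
  calc _ ≤ Cb * (‖η x‖ₑ * ‖mollify ρ t (fun y => χ y • v y) x‖ₑ)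
        + ‖η x‖ₑ * ‖mollify ρ t (fun y => χ y • b y (v y)) x‖ₑ := by
        simp only [← enorm_smul]
        exact add_le_add (c3 _) le_rfl
    _ ≤ Cb * (Cη * ((Cρ * Cχ : ℝ≥0) * average ρ t v x))
        + Cη * ((Cρ * (Cχ * Cb) : ℝ≥0) * average ρ t v x) := by gcongr
    _ = _ := by
        push_cast
        ring

/-- Since `ρ` has integral one, the difference is ∫ ρ(z) (h(x - tz) - h(x)) dz, and `h` is
Lipschitz. -/
theorem exists_norm_mollify_sub_le [CompleteSpace F] {ρ : E → ℝ} (hρ : ContDiff ℝ ∞ ρ)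
    (hρc : HasCompactSupport ρ) (hρ1 : ∫ z, ρ z = 1) {h : E → F} (hh : ContDiff ℝ ∞ h)
    (hhc : HasCompactSupport h) :
    ∃ C : ℝ, ∀ t : ℝ, 0 < t → ∀ x, ‖mollify ρ t h x - h x‖ ≤ C * t := by
  obtain ⟨R, hR⟩ := hρc.isCompact.isBounded.exists_norm_le
  obtain ⟨L, hL⟩ := hh.lipschitzWith_of_hasCompactSupport hhc (by simp)
  refine ⟨∫ z, ‖ρ z‖ * (L * R), fun t ht x => ?_⟩
  have hch := hh.continuous
  have hcρ := hρ.continuous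
  have hi1 : Integrable fun z => ρ z • h (x - t • z) :=
    Continuous.integrable_of_hasCompactSupport (by fun_prop) hρc.smul_right
  have hi2 : Integrable ρ := hcρ.integrable_of_hasCompactSupport hρc
  have e1 : mollify ρ t h x - h x = ∫ z, ρ z • (h (x - t • z) - h x) := by
    simp only [smul_sub]
    rw [integral_sub hi1 (hi2.smul_const _), integral_smul_const, hρ1, one_smul, mollify]
  rw [e1, ← integral_mul_const]
  refine norm_integral_le_of_norm_le ((hi2.norm.mul_const _).mul_const _) (.of_forall fun z => ?_)
  by_cases hz : z ∈ tsupport ρ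
  · rw [norm_smul, mul_assoc]
    gcongr
    refine (hL.norm_sub_le _ _).trans ?_
    rw [sub_sub_cancel_left, norm_neg, norm_smul, Real.norm_of_nonneg ht.le, mul_assoc, mul_comm t]
    gcongr
    exact hR z hz
  · simp [image_eq_zero_of_notMem_tsupport hz]

end Friedrichs

end

/-! ### Test functions, bundle charts, and passage between sections and fibre coordinates. -/

noncomputable section

namespace HermitianBundle

open Friedrichs NNReal

section Euclidean

variable {E : Type*} [NormedAddCommGroup E] [NormedSpace ℝ E] [FiniteDimensional ℝ E]

/-- The smooth functions with compact support contained in `U`. -/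
structure IsTestFunction {G : Type*} [NormedAddCommGroup G] [NormedSpace ℝ G] (U : Set E)
    (g : E → G) : Prop where
  contDiff : ContDiff ℝ ∞ g
  hasCompactSupport : HasCompactSupport g
  tsupport_subset : tsupport g ⊆ U

variable {G : Type*} [NormedAddCommGroup G] [NormedSpace ℝ G] {U : Set E}

/-- Off the support of `θ` the product is locally zero, so the values of `a` outside `U` are
irrelevant. -/
theorem IsTestFunction.smul {θ : E → ℝ} (hθ : IsTestFunction U θ) (hU : IsOpen U) {a : E → G}
    (ha : ContDiffOn ℝ ∞ a U) : IsTestFunction U (fun x => θ x • a x) where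
  contDiff := by
    rw [contDiff_iff_contDiffAt]
    intro x
    by_cases hx : x ∈ tsupport θ
    · exact hθ.contDiff.contDiffAt.smul
        (ha.contDiffAt (hU.mem_nhds (hθ.tsupport_subset hx)))
    · refine contDiffAt_const (c := (0 : G)) |>.congr_of_eventuallyEq ?_
      filter_upwards [(isClosed_tsupport θ).isOpen_compl.mem_nhds hx] with y hy
      rw [image_eq_zero_of_notMem_tsupport hy, zero_smul]
  hasCompactSupport := hθ.hasCompactSupport.smul_right
  tsupport_subset := (tsupport_smul_subset_left θ a).trans hθ.tsupport_subset

theorem IsTestFunction.add {g h : E → G} (hg : IsTestFunction U g) (hh : IsTestFunction U h) :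
    IsTestFunction U (g + h) where
  contDiff := hg.contDiff.add hh.contDiff
  hasCompactSupport := hg.hasCompactSupport.add hh.hasCompactSupport
  tsupport_subset := (tsupport_add g h).trans (union_subset hg.tsupport_subset hh.tsupport_subset)

/-- Being one near each point of `L`, not only on `L`, makes multiplication by `θ` preserve
derivatives on `L`. -/
theorem exists_isTestFunction_one_nhds {L : Set E} (hL : IsCompact L) (hU : IsOpen U)
    (hLU : L ⊆ U) :
    ∃ θ : E → ℝ, IsTestFunction U θ ∧ ∀ x ∈ L, ∀ᶠ y in 𝓝 x, θ y = 1 := by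
  obtain ⟨L', hL', hLL', hL'U⟩ := exists_compact_between hL hU hLU
  obtain ⟨f, hf1, hf0, -⟩ := exists_contMDiffMap_one_nhds_of_subset_interior (n := (⊤ : ℕ∞)) 𝓘(ℝ, E)
    hL.isClosed hLL'
  have hsupp : tsupport f ⊆ L' := closure_minimal (fun x hx => by
    by_contra h
    exact hx (hf0 x h)) hL'.isClosed
  refine ⟨f, ⟨f.contMDiff.contDiff, hL'.of_isClosed_subset (isClosed_tsupport _) hsupp,
    hsupp.trans hL'U⟩, fun x hx => ?_⟩
  exact hf1.filter_mono (nhds_le_nhdsSet hx)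

end Euclidean

variable {n : ℕ} {M : Type*} [TopologicalSpace M]
  [ChartedSpace (EuclideanSpace ℝ (Fin n)) M]
  {F : Type*} [NormedAddCommGroup F] [NormedSpace ℂ F]
  {S : M → Type*} [TopologicalSpace (TotalSpace F S)]
  [∀ p, NormedAddCommGroup (S p)] [∀ p, InnerProductSpace ℂ (S p)]
  [FiberBundle F S]

variable (n F S) in
/-- A chart of the base together with a trivialization of the bundle over its domain. -/
structure BundleChart where
  /-- The chart of the base. -/
  chart : OpenPartialHomeomorph M (EuclideanSpace ℝ (Fin n))
  /-- The trivialization of the bundle. -/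
  triv : Trivialization F (π F S)
  chart_mem : chart ∈ IsManifold.maximalAtlas (𝓡 n) ∞ M
  triv_mem : MemTrivializationAtlas triv
  source_subset : chart.source ⊆ triv.baseSet

namespace BundleChart

attribute [instance] BundleChart.triv_mem

variable (F S) in
theorem exists_mem_source [IsManifold (𝓡 n) ∞ M] (p : M) :
    ∃ c : BundleChart n F S, p ∈ c.chart.source := by
  have hU := (trivializationAt F S p).open_baseSet
  refine ⟨⟨(chartAt (EuclideanSpace ℝ (Fin n)) p).restr (trivializationAt F S p).baseSet,
    trivializationAt F S p,
    restr_mem_maximalAtlas _ (IsManifold.chart_mem_maximalAtlas p) hU, inferInstance, ?_⟩, ?_⟩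
  · rw [OpenPartialHomeomorph.restr_source' _ _ hU]
    exact inter_subset_right
  · rw [OpenPartialHomeomorph.restr_source' _ _ hU]
    exact ⟨mem_chart_source _ p, FiberBundle.mem_baseSet_trivializationAt F S p⟩

variable (c : BundleChart n F S)

/-- The fibre coordinates of a section. -/
def coord (u : ∀ p, S p) (x : EuclideanSpace ℝ (Fin n)) : F :=
  (c.triv (TotalSpace.mk' F (c.chart.symm x) (u (c.chart.symm x)))).2

open Classical in
/-- The section with given fibre coordinates, extended by zero. -/
def lift (g : EuclideanSpace ℝ (Fin n) → F) (p : M) : S p :=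
  if p ∈ c.chart.source then c.triv.symm p (g (c.chart p)) else 0

theorem mem_baseSet {x : EuclideanSpace ℝ (Fin n)} (hx : x ∈ c.chart.target) :
    c.chart.symm x ∈ c.triv.baseSet := c.source_subset (c.chart.map_target hx)

theorem lift_of_mem {g : EuclideanSpace ℝ (Fin n) → F} {p : M} (hp : p ∈ c.chart.source) :
    c.lift g p = c.triv.symm p (g (c.chart p)) := if_pos hp

theorem lift_of_notMem {g : EuclideanSpace ℝ (Fin n) → F} {p : M} (hp : p ∉ c.chart.source) :
    c.lift g p = 0 := if_neg hp

theorem coord_lift {g : EuclideanSpace ℝ (Fin n) → F} {x : EuclideanSpace ℝ (Fin n)}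
    (hx : x ∈ c.chart.target) : c.coord (c.lift g) x = g x := by
  rw [coord, lift_of_mem _ (c.chart.map_target hx), TotalSpace.mk',
    c.triv.apply_mk_symm (c.mem_baseSet hx), c.chart.right_inv hx]

theorem symm_coord (u : ∀ p, S p) {p : M} (hp : p ∈ c.chart.source) :
    c.triv.symm p (c.coord u (c.chart p)) = u p := by
  rw [coord, c.chart.left_inv hp]
  exact c.triv.symm_apply_apply_mk (c.source_subset hp) _

variable [VectorBundle ℂ F S]

theorem symm_eq {p : M} (hp : p ∈ c.chart.source) (w : F) :
    c.triv.symm p w =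
      (c.triv.continuousLinearEquivAt ℂ p (c.source_subset hp)).symm w := by
  rw [Trivialization.continuousLinearEquivAt_symm_apply]

theorem coord_eq (u : ∀ p, S p) {x : EuclideanSpace ℝ (Fin n)} (hx : x ∈ c.chart.target) :
    c.coord u x =
      c.triv.continuousLinearEquivAt ℂ (c.chart.symm x) (c.mem_baseSet hx) (u (c.chart.symm x)) :=
  rfl

theorem coord_add (u v : ∀ p, S p) {x : EuclideanSpace ℝ (Fin n)} (hx : x ∈ c.chart.target) :
    c.coord (u + v) x = c.coord u x + c.coord v x := by
  simp only [coord_eq c _ hx, Pi.add_apply, map_add]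

theorem coord_smul (a : ℂ) (u : ∀ p, S p) {x : EuclideanSpace ℝ (Fin n)}
    (hx : x ∈ c.chart.target) : c.coord (a • u) x = a • c.coord u x := by
  simp only [coord_eq c _ hx, Pi.smul_apply, map_smul]

theorem lift_add (g h : EuclideanSpace ℝ (Fin n) → F) : c.lift (g + h) = c.lift g + c.lift h := by
  ext p
  by_cases hp : p ∈ c.chart.source
  · simp only [lift_of_mem c hp, Pi.add_apply]
    rw [symm_eq c hp, symm_eq c hp, symm_eq c hp, map_add]
  · simp [lift_of_notMem c hp]

theorem lift_smul (a : ℂ) (g : EuclideanSpace ℝ (Fin n) → F) :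
    c.lift (a • g) = a • c.lift g := by
  ext p
  by_cases hp : p ∈ c.chart.source
  · simp only [lift_of_mem c hp, Pi.smul_apply]
    rw [symm_eq c hp, symm_eq c hp, map_smul]
  · simp [lift_of_notMem c hp]

variable [ContMDiffVectorBundle ∞ F S (𝓡 n)]

theorem isSmoothTrivialization [IsManifold (𝓡 n) ∞ M] : IsSmoothTrivialization n c.triv where
  isLinear := inferInstance
  contMDiffOn := c.triv.contMDiffOn
  contMDiffOn_symm := c.triv.contMDiffOn_symm

theorem contDiffOn_coord [IsManifold (𝓡 n) ∞ M] {u : ∀ p, S p} (hu : IsSmoothSection n F S u) :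
    ContDiffOn ℝ ∞ (c.coord u) c.chart.target := by
  have h1 : ContMDiffOn (𝓡 n) 𝓘(ℝ, F) ∞ (fun p => (c.triv (TotalSpace.mk' F p (u p))).2)
      c.chart.source :=
    (c.triv.contMDiffOn_section_iff c.chart.open_source c.source_subset).1 hu.contMDiffOn
  exact (h1.comp (contMDiffOn_symm_of_mem_maximalAtlas c.chart_mem)
    c.chart.mapsTo_symm).contDiffOn

/-- The image of the compact support is closed because `M` is Hausdorff. Hence extension by zero is
smooth across the boundary of the chart domain. -/
theorem eventually_lift_eq_zero [T2Space M] {g : EuclideanSpace ℝ (Fin n) → F}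
    (hg : IsTestFunction c.chart.target g) {p : M} (hp : p ∉ c.chart.symm '' tsupport g) :
    ∀ᶠ q in 𝓝 p, c.lift g q = 0 := by
  have hc : IsCompact (c.chart.symm '' tsupport g) :=
    hg.hasCompactSupport.isCompact.image_of_continuousOn
      (c.chart.continuousOn_symm.mono hg.tsupport_subset)
  filter_upwards [hc.isClosed.isOpen_compl.mem_nhds hp] with q hq
  by_cases hqs : q ∈ c.chart.source
  · have : c.chart q ∉ tsupport g := fun h => hq ⟨_, h, c.chart.left_inv hqs⟩
    rw [lift_of_mem c hqs, image_eq_zero_of_notMem_tsupport this, symm_eq c hqs, map_zero]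
  · exact lift_of_notMem c hqs

theorem sectionSupport_lift_subset [T2Space M] {g : EuclideanSpace ℝ (Fin n) → F}
    (hg : IsTestFunction c.chart.target g) :
    sectionSupport (c.lift g) ⊆ c.chart.symm '' tsupport g := by
  intro p hp
  by_contra h
  obtain ⟨q, hq, hq'⟩ := ((mem_closure_iff_frequently.1 hp).and_eventually
    (c.eventually_lift_eq_zero hg h)).exists
  exact hq hq'

theorem lift_mem_testSections [T2Space M] [IsManifold (𝓡 n) ∞ M]
    {g : EuclideanSpace ℝ (Fin n) → F} (hg : IsTestFunction c.chart.target g) :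
    c.lift g ∈ testSections n F S := by
  refine ⟨fun p => ?_, ?_⟩
  · by_cases hp : p ∈ c.chart.source
    · refine (c.triv.contMDiffAt_section_iff (c.source_subset hp)).2 ?_
      have h1 : ContMDiffAt (𝓡 n) 𝓘(ℝ, F) ∞ (fun q => g (c.chart q)) p :=
        hg.contDiff.contMDiff.contMDiffAt.comp p
          (contMDiffAt_of_mem_maximalAtlas c.chart_mem hp)
      refine h1.congr_of_eventuallyEq ?_
      filter_upwards [c.chart.open_source.mem_nhds hp] with q hq
      rw [lift_of_mem c hq, c.triv.apply_mk_symm (c.source_subset hq)]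
    · have hp' : p ∉ c.chart.symm '' tsupport g := by
        rintro ⟨x, hx, rfl⟩
        exact hp (c.chart.map_target (hg.tsupport_subset hx))
      refine (contMDiff_zeroSection ℝ S p).congr_of_eventuallyEq ?_
      filter_upwards [c.eventually_lift_eq_zero hg hp'] with q hq
      rw [hq]
      rfl
  · exact (hg.hasCompactSupport.isCompact.image_of_continuousOn
      (c.chart.continuousOn_symm.mono hg.tsupport_subset)).of_isClosed_subset isClosed_closure
      (c.sectionSupport_lift_subset hg)

end BundleChart

end HermitianBundle

end

/-! ### Comparison of the norms of a section and of its coordinates. -/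

noncomputable section

namespace HermitianBundle

open Friedrichs NNReal

variable {n : ℕ} {M : Type*} [TopologicalSpace M]
  [ChartedSpace (EuclideanSpace ℝ (Fin n)) M]
  {F : Type*} [NormedAddCommGroup F] [NormedSpace ℂ F]
  {S : M → Type*} [TopologicalSpace (TotalSpace F S)]
  [∀ p, NormedAddCommGroup (S p)] [∀ p, InnerProductSpace ℂ (S p)]
  [FiberBundle F S]

variable (n F S) in
theorem IsHermitian.continuous_norm [IsHermitian n F S] {u : ∀ p, S p}
    (hu : IsSmoothSection n F S u) : Continuous fun p => ‖u p‖ := by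
  have h : Continuous fun p => RCLike.re (inner ℂ (u p) (u p)) :=
    RCLike.continuous_re.comp (IsHermitian.contMDiff_inner (n := n) (F := F) u u hu hu).continuous
  simp only [inner_self_eq_norm_sq] at h
  simpa [Real.sqrt_sq] using h.sqrt

namespace BundleChart

variable (c : BundleChart n F S) [VectorBundle ℂ F S] [ContMDiffVectorBundle ∞ F S (𝓡 n)]

section Norm

variable [T2Space M] [IsManifold (𝓡 n) ∞ M] [IsHermitian n F S]

/-- Smoothness of the metric is only given on global sections, so the constant local section `w` is
cut off and extended by zero. -/
theorem continuousOn_norm_symm {L : Set (EuclideanSpace ℝ (Fin n))} (hL : IsCompact L)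
    (hLt : L ⊆ c.chart.target) (w : F) :
    ContinuousOn (fun x => ‖c.triv.symm (c.chart.symm x) w‖) L := by
  obtain ⟨θ, hθ, hθ1⟩ := exists_isTestFunction_one_nhds hL c.chart.open_target hLt
  have hg : IsTestFunction c.chart.target fun x => θ x • w :=
    hθ.smul c.chart.open_target contDiffOn_const
  have hs := IsHermitian.continuous_norm n F S (c.lift_mem_testSections hg).1
  refine (hs.comp_continuousOn (c.chart.continuousOn_symm.mono hLt)).congr fun x hx => ?_
  simp only [Function.comp_def]
  rw [lift_of_mem c (c.chart.map_target (hLt hx)), c.chart.right_inv (hLt hx),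
    (hθ1 x hx).self_of_nhds, one_smul]

variable [FiniteDimensional ℂ F]

/-- Expand `w` in a basis; each basis vector has bounded norm over the compact set. -/
theorem exists_nnnorm_symm_le {L : Set (EuclideanSpace ℝ (Fin n))} (hL : IsCompact L)
    (hLt : L ⊆ c.chart.target) :
    ∃ C : ℝ≥0, ∀ x ∈ L, ∀ w : F, ‖c.triv.symm (c.chart.symm x) w‖₊ ≤ C * ‖w‖₊ := by
  set b := Module.finBasis ℂ F
  choose C hC using fun i => hL.exists_bound_of_continuousOn (c.continuousOn_norm_symm hL hLt (b i))
  set ℓ : Fin (Module.finrank ℂ F) → F →L[ℂ] ℂ := fun i =>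
    LinearMap.toContinuousLinearMap (b.coord i)
  refine ⟨(∑ i, ‖ℓ i‖ * C i).toNNReal, fun x hx w => ?_⟩
  have hp := c.chart.map_target (hLt hx)
  have hC' : ∀ i, ‖c.triv.symm (c.chart.symm x) (b i)‖ ≤ C i := fun i => by
    simpa using hC i x hx
  have hpos : 0 ≤ ∑ i, ‖ℓ i‖ * C i :=
    Finset.sum_nonneg fun i _ => mul_nonneg (norm_nonneg _) ((norm_nonneg _).trans (hC' i))
  rw [← NNReal.coe_le_coe, NNReal.coe_mul, Real.coe_toNNReal _ hpos, coe_nnnorm, coe_nnnorm]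
  calc ‖c.triv.symm (c.chart.symm x) w‖
      = ‖∑ i, ℓ i w • c.triv.symm (c.chart.symm x) (b i)‖ := by
        conv_lhs => rw [← b.sum_repr w]
        simp only [symm_eq c hp, map_sum, map_smul]
        rfl
    _ ≤ ∑ i, ‖ℓ i w • c.triv.symm (c.chart.symm x) (b i)‖ := norm_sum_le _ _
    _ ≤ ∑ i, (‖ℓ i‖ * C i) * ‖w‖ := by
        refine Finset.sum_le_sum fun i _ => ?_
        rw [norm_smul, mul_right_comm]
        exact mul_le_mul ((ℓ i).le_opNorm w) (hC' i) (norm_nonneg _) (by positivity)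
    _ = (∑ i, ‖ℓ i‖ * C i) * ‖w‖ := (Finset.sum_mul ..).symm

/-- The fibre norm is positive on the compact product of `L` with the unit sphere, hence bounded
below there; homogeneity does the rest. Joint continuity comes from continuity in `x` and a
Lipschitz bound in `w` uniform in `x`. -/
theorem exists_nnnorm_le_symm {L : Set (EuclideanSpace ℝ (Fin n))} (hL : IsCompact L)
    (hLt : L ⊆ c.chart.target) :
    ∃ C : ℝ≥0, ∀ x ∈ L, ∀ w : F, ‖w‖₊ ≤ C * ‖c.triv.symm (c.chart.symm x) w‖₊ := by
  obtain ⟨C, hC⟩ := c.exists_nnnorm_symm_le hL hLt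
  have : ProperSpace F := FiniteDimensional.proper ℂ F
  have hcont : ContinuousOn (fun q : EuclideanSpace ℝ (Fin n) × F =>
      ‖c.triv.symm (c.chart.symm q.1) q.2‖) (L ×ˢ Metric.sphere (0 : F) 1) := by
    refine continuousOn_prod_of_continuousOn_lipschitzOnWith' _ C (fun x hx => ?_)
      fun w _ => c.continuousOn_norm_symm hL hLt w
    refine LipschitzOnWith.of_dist_le_mul fun w _ w' _ => ?_
    have hp := c.chart.map_target (hLt hx)
    rw [Real.dist_eq, dist_eq_norm]
    refine (abs_norm_sub_norm_le _ _).trans ?_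
    have h := hC x hx (w - w')
    rw [symm_eq c hp, map_sub, ← symm_eq c hp, ← symm_eq c hp] at h
    exact h
  obtain ⟨m, hm, hmin⟩ := (hL.prod (isCompact_sphere (0 : F) 1)).exists_forall_le' hcont
    (a := 0) (by
      rintro ⟨x, w⟩ ⟨hx, hw⟩
      have hp := c.chart.map_target (hLt hx)
      have hw0 : w ≠ 0 := by
        rintro rfl
        simp at hw
      simp only
      rw [symm_eq c hp, norm_pos_iff]
      exact (map_ne_zero_iff _ (ContinuousLinearEquiv.injective _)).2 hw0)
  refine ⟨m⁻¹.toNNReal, fun x hx w => ?_⟩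
  rw [← NNReal.coe_le_coe, NNReal.coe_mul, Real.coe_toNNReal _ (inv_pos.2 hm).le, coe_nnnorm,
    coe_nnnorm]
  rcases eq_or_ne w 0 with rfl | hw
  · simpa using mul_nonneg (inv_pos.2 hm).le (norm_nonneg _)
  have hp := c.chart.map_target (hLt hx)
  have hw' : 0 < ‖w‖ := norm_pos_iff.2 hw
  have h := hmin (x, ((‖w‖⁻¹ : ℝ) : ℂ) • w) ⟨hx, by simp [norm_smul, hw'.ne']⟩
  simp only at h
  rw [symm_eq c hp, map_smul, ← symm_eq c hp, norm_smul, Complex.norm_real, norm_inv, norm_norm,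
    inv_mul_eq_div, le_div_iff₀ hw'] at h
  rwa [inv_mul_eq_div, le_div_iff₀ hm, mul_comm]

end Norm

section Measure

variable [MeasurableSpace M] [BorelSpace M] (μ : Measure M) [IsSmoothMeasure n μ]

theorem exists_density_lintegral_eq :
    ∃ f : EuclideanSpace ℝ (Fin n) → ℝ, ContinuousOn f c.chart.target ∧
      (∀ x ∈ c.chart.target, 0 < f x) ∧
      ∀ h : M → ℝ≥0∞, Continuous h → ∫⁻ p in c.chart.source, h p ∂μ =
        ∫⁻ x in c.chart.target, ENNReal.ofReal (f x) * h (c.chart.symm x) := by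
  obtain ⟨f, hf, hpos, hmap⟩ := IsSmoothMeasure.exists_density (n := n) (μ := μ) c.chart c.chart_mem
  refine ⟨f, hf.continuousOn, hpos, fun h hh => ?_⟩
  have ht := c.chart.open_target.measurableSet
  have hs := c.chart.open_source.measurableSet
  have hG : AEMeasurable (fun x => h (c.chart.symm x)) (volume.restrict c.chart.target) :=
    (hh.comp_continuousOn c.chart.continuousOn_symm).aemeasurable ht
  have hf' : AEMeasurable (fun x => ENNReal.ofReal (f x)) (volume.restrict c.chart.target) :=
    (hf.continuousOn.aemeasurable ht).ennreal_ofReal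
  have hG' := hG.mono' (withDensity_absolutelyContinuous _ fun x => ENNReal.ofReal (f x))
  have h1 := lintegral_withDensity_eq_lintegral_mul₀ hf' hG
  rw [← hmap] at h1 hG'
  rw [lintegral_map' hG' (c.chart.continuousOn.aemeasurable hs)] at h1
  rw [← setLIntegral_congr_fun (f := fun p => h (c.chart.symm (c.chart p))) hs
    fun p hp => congrArg h (c.chart.left_inv hp)]
  exact h1

end Measure

end BundleChart

section L2Norm

variable [VectorBundle ℂ F S] [MeasurableSpace M] {μ : Measure M} [BorelSpace M]
  [IsManifold (𝓡 n) ∞ M] [IsHermitian n F S] [IsSmoothMeasure n μ]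

theorem continuous_enorm_testSection (u : TestSections n F S μ) : Continuous fun p => ‖u.1 p‖ₑ := by
  simp only [← ofReal_norm]
  exact ENNReal.continuous_ofReal.comp (IsHermitian.continuous_norm n F S u.2.1)

theorem enorm_sq_testSection (u : TestSections n F S μ) : ‖u‖ₑ ^ 2 = ∫⁻ p, ‖u.1 p‖ₑ ^ 2 ∂μ := by
  have hi := integrable_inner_section n F S μ u u
  have h1 : ‖u‖ ^ 2 = ∫ p, ‖u.1 p‖ ^ 2 ∂μ := by
    rw [← inner_self_eq_norm_sq (𝕜 := ℂ) u]
    change RCLike.re (∫ p, inner ℂ (u.1 p) (u.1 p) ∂μ) = _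
    rw [← integral_re hi]
    simp only [inner_self_eq_norm_sq]
  have h2 : Integrable (fun p => ‖u.1 p‖ ^ 2) μ := by
    have := hi.re
    simpa only [inner_self_eq_norm_sq] using this
  rw [← ofReal_norm, ← ENNReal.ofReal_pow (norm_nonneg _), h1,
    ofReal_integral_eq_lintegral_ofReal h2 (.of_forall fun p => by positivity)]
  refine lintegral_congr fun p => ?_
  rw [← ofReal_norm, ← ENNReal.ofReal_pow (norm_nonneg _)]

end L2Norm

namespace BundleChart

variable (c : BundleChart n F S) [VectorBundle ℂ F S] [ContMDiffVectorBundle ∞ F S (𝓡 n)]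
  [T2Space M] [IsManifold (𝓡 n) ∞ M] [IsHermitian n F S] [FiniteDimensional ℂ F]
  [MeasurableSpace M] [BorelSpace M] (μ : Measure M) [IsSmoothMeasure n μ]

theorem le_of_sq_le_mul_sq {a b : ℝ≥0∞} {C : ℝ≥0} (h : a ^ 2 ≤ (C : ℝ≥0∞) ^ 2 * b ^ 2) :
    a ≤ C * b := by
  rw [← mul_pow] at h
  exact (ENNReal.pow_le_pow_left_iff two_ne_zero).1 h

theorem eLpNorm_two_sq {α G : Type*} [MeasurableSpace α] [NormedAddCommGroup G] (f : α → G)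
    (ν : Measure α) : eLpNorm f 2 ν ^ 2 = ∫⁻ x, ‖f x‖ₑ ^ 2 ∂ν := by
  rw [eLpNorm_two_eq, ← ENNReal.rpow_natCast, ← ENNReal.rpow_mul]
  norm_num

/-- The fibre coordinates of a section are bounded by the section in the `L²` norm. -/
theorem exists_eLpNorm_smul_coord_le {θ : EuclideanSpace ℝ (Fin n) → ℝ}
    (hθ : IsTestFunction c.chart.target θ) :
    ∃ C : ℝ≥0, ∀ u : TestSections n F S μ,
      eLpNorm (fun x => θ x • c.coord u.1 x) 2 volume ≤ C * ‖u‖ₑ := by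
  have hL := hθ.hasCompactSupport.isCompact
  obtain ⟨f, hf, hpos, hint⟩ := c.exists_density_lintegral_eq μ
  obtain ⟨C₁, hC₁⟩ := c.exists_nnnorm_le_symm hL hθ.tsupport_subset
  obtain ⟨C₂, hC₂⟩ := exists_nnnorm_le hθ.contDiff.continuous hθ.hasCompactSupport
  obtain ⟨m, hm, hmin⟩ := hL.exists_forall_le' (hf.mono hθ.tsupport_subset) (a := 0)
    fun x hx => hpos x (hθ.tsupport_subset hx)
  -- `m` is a positive lower bound of the density on the support of `θ`, so D² f ≥ 1 there.
  set D : ℝ≥0 := NNReal.sqrt m⁻¹.toNNReal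
  have hD : ∀ x ∈ tsupport θ, 1 ≤ (D : ℝ≥0∞) ^ 2 * ENNReal.ofReal (f x) := by
    intro x hx
    have : (D : ℝ≥0∞) ^ 2 = ENNReal.ofReal m⁻¹ := by
      rw [← ENNReal.coe_pow, NNReal.sq_sqrt]
      rfl
    rw [this, ← ENNReal.ofReal_mul (inv_pos.2 hm).le, ENNReal.one_le_ofReal, inv_mul_eq_div,
      one_le_div hm]
    exact hmin x hx
  refine ⟨C₂ * C₁ * D, fun u => le_of_sq_le_mul_sq ?_⟩
  have hcont : Continuous fun p => ‖u.1 p‖ₑ ^ 2 := ENNReal.continuous_pow 2 |>.comp (continuous_enorm_testSection u)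
  have hsub : Function.support (fun x => ‖θ x • c.coord u.1 x‖ₑ ^ 2) ⊆ c.chart.target := by
    intro x hx
    refine hθ.tsupport_subset (subset_tsupport _ fun h => hx ?_)
    simp [h]
  rw [eLpNorm_two_sq, enorm_sq_testSection, ← setLIntegral_eq_of_support_subset hsub]
  calc ∫⁻ x in c.chart.target, ‖θ x • c.coord u.1 x‖ₑ ^ 2
      ≤ ∫⁻ x in c.chart.target, ((C₂ * C₁ * D : ℝ≥0) : ℝ≥0∞) ^ 2 *
          (ENNReal.ofReal (f x) * ‖u.1 (c.chart.symm x)‖ₑ ^ 2) := by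
        refine setLIntegral_mono' c.chart.open_target.measurableSet fun x hx => ?_
        by_cases hxL : x ∈ tsupport θ
        · have h1 : ‖θ x • c.coord u.1 x‖ₑ ≤ (C₂ * C₁ : ℝ≥0) * ‖u.1 (c.chart.symm x)‖ₑ := by
            refine enorm_le_of_nnnorm_le ?_
            rw [nnnorm_smul, mul_assoc]
            gcongr
            · exact hC₂ x
            · have h := hC₁ x hxL (c.coord u.1 x)
              have h' := c.symm_coord u.1 (c.chart.map_target hx)
              rw [c.chart.right_inv hx] at h'
              rwa [h'] at h
          calc _ ≤ ((C₂ * C₁ : ℝ≥0) * ‖u.1 (c.chart.symm x)‖ₑ) ^ 2 * 1 := by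
                rw [mul_one]
                gcongr
            _ ≤ ((C₂ * C₁ : ℝ≥0) * ‖u.1 (c.chart.symm x)‖ₑ) ^ 2 *
                  ((D : ℝ≥0∞) ^ 2 * ENNReal.ofReal (f x)) := by
                gcongr
                exact hD x hxL
            _ = _ := by
                push_cast
                ring
        · simp [image_eq_zero_of_notMem_tsupport hxL]
    _ = ((C₂ * C₁ * D : ℝ≥0) : ℝ≥0∞) ^ 2 * ∫⁻ p in c.chart.source, ‖u.1 p‖ₑ ^ 2 ∂μ := by
        rw [hint _ hcont, lintegral_const_mul' _ _ (ENNReal.pow_ne_top ENNReal.coe_ne_top)]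
    _ ≤ _ := by
        gcongr
        exact Measure.restrict_le_self

/-- A section is bounded by its fibre coordinates in the `L²` norm. -/
theorem exists_enorm_lift_le {L : Set (EuclideanSpace ℝ (Fin n))} (hL : IsCompact L)
    (hLt : L ⊆ c.chart.target) :
    ∃ C : ℝ≥0, ∀ (g : EuclideanSpace ℝ (Fin n) → F) (v : TestSections n F S μ),
      tsupport g ⊆ L → v.1 = c.lift g → ‖v‖ₑ ≤ C * eLpNorm g 2 volume := by
  obtain ⟨f, hf, hpos, hint⟩ := c.exists_density_lintegral_eq μ
  obtain ⟨C₁, hC₁⟩ := c.exists_nnnorm_symm_le hL hLt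
  obtain ⟨m, hm⟩ := hL.exists_bound_of_continuousOn (hf.mono hLt)
  -- Here `m` bounds the density from above on `L`, so f ≤ D² there.
  set D : ℝ≥0 := NNReal.sqrt m.toNNReal
  have hD : ∀ x ∈ L, ENNReal.ofReal (f x) ≤ (D : ℝ≥0∞) ^ 2 := by
    intro x hx
    have : (D : ℝ≥0∞) ^ 2 = ENNReal.ofReal m := by
      rw [← ENNReal.coe_pow, NNReal.sq_sqrt]
      rfl
    rw [this]
    exact ENNReal.ofReal_le_ofReal ((le_abs_self _).trans (hm x hx))
  refine ⟨D * C₁, fun g v hg hv => le_of_sq_le_mul_sq ?_⟩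
  have hcont : Continuous fun p => ‖v.1 p‖ₑ ^ 2 := ENNReal.continuous_pow 2 |>.comp (continuous_enorm_testSection v)
  have hsub : Function.support (fun p => ‖v.1 p‖ₑ ^ 2) ⊆ c.chart.source := by
    intro p hp
    by_contra h
    refine hp ?_
    simp [hv, lift_of_notMem c h]
  rw [eLpNorm_two_sq, enorm_sq_testSection, ← setLIntegral_eq_of_support_subset hsub,
    hint _ hcont, ← lintegral_const_mul' _ _ (ENNReal.pow_ne_top ENNReal.coe_ne_top)]
  refine (setLIntegral_mono' c.chart.open_target.measurableSet fun x hx => ?_).trans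
    (setLIntegral_le_lintegral c.chart.target _)
  have hp := c.chart.map_target hx
  rw [hv, lift_of_mem c hp, c.chart.right_inv hx]
  by_cases hxL : x ∈ L
  · calc _ ≤ (D : ℝ≥0∞) ^ 2 * (C₁ * ‖g x‖ₑ) ^ 2 := by
          gcongr
          · exact hD x hxL
          · exact enorm_le_of_nnnorm_le (hC₁ x hxL _)
      _ = _ := by
          push_cast
          ring
  · rw [image_eq_zero_of_notMem_tsupport fun h => hxL (hg h), symm_eq c hp, map_zero]
    simp

end BundleChart

end HermitianBundle

end

/-! ### The mollifier in one chart: extension to `L²`, uniform bound, convergence. -/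

noncomputable section

namespace HermitianBundle

open Friedrichs NNReal

section Kernel

variable (E : Type*) [NormedAddCommGroup E] [NormedSpace ℝ E] [FiniteDimensional ℝ E]
  [MeasureSpace E] [BorelSpace E] [(volume : Measure E).IsAddHaarMeasure]

/-- A smooth function with compact support and integral one. -/
def kernel : E → ℝ := (⟨1, 2, one_pos, one_lt_two⟩ : ContDiffBump (0 : E)).normed volume

theorem contDiff_kernel : ContDiff ℝ ∞ (kernel E) := ContDiffBump.contDiff_normed _

theorem hasCompactSupport_kernel : HasCompactSupport (kernel E) :=
  ContDiffBump.hasCompactSupport_normed _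

theorem integral_kernel : ∫ x, kernel E x = 1 := ContDiffBump.integral_normed _

end Kernel

/-- The space of smooth functions with compact support contained in `U`. -/
def testFunctions {E : Type*} [NormedAddCommGroup E] [NormedSpace ℝ E] [FiniteDimensional ℝ E]
    (G : Type*) [NormedAddCommGroup G] [NormedSpace ℂ G] (U : Set E) : Submodule ℂ (E → G) where
  carrier := {g | IsTestFunction U g}
  add_mem' hg hh := hg.add hh
  zero_mem' := ⟨contDiff_const, HasCompactSupport.zero, by simp [tsupport]⟩
  smul_mem' a g hg :=
    have hs : tsupport (a • g) ⊆ tsupport g := closure_mono (Function.support_const_smul_subset a g)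
    ⟨hg.contDiff.const_smul a, hg.hasCompactSupport.of_isClosed_subset (isClosed_tsupport _) hs,
      hs.trans hg.tsupport_subset⟩

variable {n : ℕ} {M : Type*} [TopologicalSpace M]
  [ChartedSpace (EuclideanSpace ℝ (Fin n)) M]
  {F : Type*} [NormedAddCommGroup F] [NormedSpace ℂ F]
  {S : M → Type*} [TopologicalSpace (TotalSpace F S)]
  [∀ p, NormedAddCommGroup (S p)] [∀ p, InnerProductSpace ℂ (S p)]
  [FiberBundle F S]

namespace BundleChart

variable (c : BundleChart n F S) [VectorBundle ℂ F S] [ContMDiffVectorBundle ∞ F S (𝓡 n)]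
  [T2Space M] [IsManifold (𝓡 n) ∞ M] [IsHermitian n F S] [FiniteDimensional ℂ F]
  [MeasurableSpace M] [BorelSpace M] (μ : Measure M) [IsSmoothMeasure n μ]

/-- The smooth compactly supported section with given fibre coordinates. -/
def liftTest : testFunctions F c.chart.target →ₗ[ℂ] TestSections n F S μ where
  toFun g := ⟨c.lift g.1, c.lift_mem_testSections g.2⟩
  map_add' g h := Subtype.ext (c.lift_add g.1 h.1)
  map_smul' a g := Subtype.ext (c.lift_smul a g.1)

variable {η χ : EuclideanSpace ℝ (Fin n) → ℝ}

theorem isTestFunction_smul_coord (hχ : IsTestFunction c.chart.target χ) {u : ∀ p, S p}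
    (hu : IsSmoothSection n F S u) : IsTestFunction c.chart.target fun x => χ x • c.coord u x :=
  hχ.smul c.chart.open_target (c.contDiffOn_coord hu)

theorem memLp_smul_coord (hχ : IsTestFunction c.chart.target χ) {u : ∀ p, S p}
    (hu : IsSmoothSection n F S u) : MemLp (fun x => χ x • c.coord u x) 2 volume :=
  (c.isTestFunction_smul_coord hχ hu).contDiff.continuous.memLp_of_hasCompactSupport
    (c.isTestFunction_smul_coord hχ hu).hasCompactSupport

/-- The fibre coordinates of a section, cut off by `χ`, as a square integrable function. -/
def coordLp (hχ : IsTestFunction c.chart.target χ) :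
    TestSections n F S μ →ₗ[ℂ] Lp F 2 (volume : Measure (EuclideanSpace ℝ (Fin n))) where
  toFun u := (c.memLp_smul_coord hχ u.2.1).toLp _
  map_add' u v := by
    rw [← MemLp.toLp_add]
    refine MemLp.toLp_congr _ _ (.of_forall fun x => ?_)
    by_cases hx : x ∈ tsupport χ
    · exact (congrArg (χ x • ·) (c.coord_add u.1 v.1 (hχ.tsupport_subset hx))).trans (smul_add ..)
    · simp [image_eq_zero_of_notMem_tsupport hx]
  map_smul' a u := by
    rw [RingHom.id_apply, ← MemLp.toLp_const_smul]
    refine MemLp.toLp_congr _ _ (.of_forall fun x => ?_)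
    by_cases hx : x ∈ tsupport χ
    · exact (congrArg (χ x • ·) (c.coord_smul a u.1 (hχ.tsupport_subset hx))).trans
        (smul_comm ..)
    · simp [image_eq_zero_of_notMem_tsupport hx]

/-- This bound is what allows `coordLp` to be extended by density to the completion. -/
theorem exists_norm_coordLp_le (hχ : IsTestFunction c.chart.target χ) :
    ∃ C : ℝ≥0, ∀ u : TestSections n F S μ, ‖c.coordLp μ hχ u‖ ≤ C * ‖toL2 n F S μ u‖ := by
  obtain ⟨C, hC⟩ := c.exists_eLpNorm_smul_coord_le μ hχ
  refine ⟨C, fun u => ?_⟩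
  rw [LinearIsometry.norm_map]
  have h := hC u
  rw [← Lp.enorm_toLp (hf := c.memLp_smul_coord hχ u.2.1)] at h
  have h' : ‖c.coordLp μ hχ u‖₊ ≤ C * ‖u‖₊ := by
    simp only [enorm_eq_nnnorm] at h
    exact_mod_cast h
  exact h'

/-- The extension of `coordLp` to the square integrable sections. -/
def coordL2 (hχ : IsTestFunction c.chart.target χ) :
    L2 n F S μ →L[ℂ] Lp F 2 (volume : Measure (EuclideanSpace ℝ (Fin n))) :=
  (c.coordLp μ hχ).extendOfNorm (toL2 n F S μ).toLinearMap

theorem coordL2_toL2 (hχ : IsTestFunction c.chart.target χ) (u : TestSections n F S μ) :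
    c.coordL2 μ hχ (toL2 n F S μ u) = c.coordLp μ hχ u := by
  obtain ⟨C, hC⟩ := c.exists_norm_coordLp_le μ hχ
  exact LinearMap.extendOfNorm_eq (f := c.coordLp μ hχ) (e := (toL2 n F S μ).toLinearMap)
    UniformSpace.Completion.denseRange_coe ⟨C, hC⟩ u

theorem isTestFunction_smul_mollify (hη : IsTestFunction c.chart.target η) {t : ℝ} (ht : 0 < t)
    {g : EuclideanSpace ℝ (Fin n) → F} (hg : LocallyIntegrable g) :
    IsTestFunction c.chart.target fun x => η x • mollify (kernel _) t g x :=
  hη.smul c.chart.open_target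
    (contDiff_mollify (contDiff_kernel _) (hasCompactSupport_kernel _) ht hg).contDiffOn

theorem locallyIntegrable_Lp {E : Type*} [NormedAddCommGroup E] [NormedSpace ℝ E]
    [FiniteDimensional ℝ E] [MeasureSpace E] [BorelSpace E]
    [(volume : Measure E).IsAddHaarMeasure] (g : Lp F 2 (volume : Measure E)) :
    LocallyIntegrable g :=
  (Lp.memLp g).locallyIntegrable (by norm_num)

/-- The section obtained from mollified fibre coordinates, cut off by `η`. -/
def mollifyLift (hη : IsTestFunction c.chart.target η) {t : ℝ} (ht : 0 < t) :
    Lp F 2 (volume : Measure (EuclideanSpace ℝ (Fin n))) →ₗ[ℂ] TestSections n F S μ :=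
  c.liftTest μ ∘ₗ
    { toFun := fun g => (⟨fun x => η x • mollify (kernel _) t g x,
        c.isTestFunction_smul_mollify hη ht (locallyIntegrable_Lp g)⟩ :
          testFunctions F c.chart.target)
      map_add' := fun g h => by
        refine Subtype.ext (funext fun x => ?_)
        change η x • mollify (kernel _) t (g + h : Lp F 2 volume) x =
          η x • mollify (kernel _) t g x + η x • mollify (kernel _) t h x
        rw [mollify_congr_ae _ ht (Lp.coeFn_add g h), mollify_add (contDiff_kernel _).continuous
          (hasCompactSupport_kernel _) ht (locallyIntegrable_Lp g) (locallyIntegrable_Lp h),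
          Pi.add_apply, smul_add]
      map_smul' := fun a g => by
        refine Subtype.ext (funext fun x => ?_)
        change η x • mollify (kernel _) t (a • g : Lp F 2 volume) x =
          a • η x • mollify (kernel _) t g x
        rw [mollify_congr_ae _ ht (Lp.coeFn_smul a g), mollify_smul, Pi.smul_apply, smul_comm] }

theorem exists_norm_mollifyLift_le (hη : IsTestFunction c.chart.target η) :
    ∃ C : ℝ≥0, ∀ (t : ℝ) (ht : 0 < t) (g : Lp F 2 (volume : Measure (EuclideanSpace ℝ (Fin n)))),
      ‖c.mollifyLift μ hη ht g‖ ≤ C * ‖g‖ := by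
  obtain ⟨C₁, hC₁⟩ := c.exists_enorm_lift_le μ hη.hasCompactSupport.isCompact hη.tsupport_subset
  obtain ⟨C₂, hC₂⟩ := exists_eLpNorm_mollify_le (F := F)
    (contDiff_kernel (EuclideanSpace ℝ (Fin n))).continuous (hasCompactSupport_kernel _)
  obtain ⟨C₃, hC₃⟩ := exists_nnnorm_le hη.contDiff.continuous hη.hasCompactSupport
  refine ⟨C₁ * (C₃ * C₂), fun t ht g => ?_⟩
  have h1 := hC₁ (fun x => η x • mollify (kernel _) t g x) (c.mollifyLift μ hη ht g)
    (tsupport_smul_subset_left η _) rfl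
  have h2 : eLpNorm (fun x => η x • mollify (kernel _) t g x) 2 volume ≤
      C₃ * eLpNorm (mollify (kernel _) t g) 2 volume := by
    refine eLpNorm_le_nnreal_smul_eLpNorm_of_ae_le_mul (.of_forall fun x => ?_) 2
    rw [nnnorm_smul]
    gcongr
    exact hC₃ x
  have h3 := hC₂ t g (Lp.stronglyMeasurable g)
  have h4 : ‖c.mollifyLift μ hη ht g‖ₑ ≤ (C₁ * (C₃ * C₂) : ℝ≥0) * ‖g‖ₑ := by
    rw [Lp.enorm_def]
    refine h1.trans ?_
    push_cast
    rw [mul_assoc, mul_assoc]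
    gcongr
    exact h2.trans (by gcongr)
  have h5 : ‖c.mollifyLift μ hη ht g‖₊ ≤ C₁ * (C₃ * C₂) * ‖g‖₊ := by
    simp only [enorm_eq_nnnorm] at h4
    exact_mod_cast h4
  exact h5

/-- The mollification of square integrable sections in a chart, with cutoffs `χ` and `η`. -/
def mollifier (hη : IsTestFunction c.chart.target η) (hχ : IsTestFunction c.chart.target χ)
    {t : ℝ} (ht : 0 < t) : L2 n F S μ →ₗ[ℂ] TestSections n F S μ :=
  c.mollifyLift μ hη ht ∘ₗ (c.coordL2 μ hχ).toLinearMap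

theorem exists_norm_mollifier_le (hη : IsTestFunction c.chart.target η)
    (hχ : IsTestFunction c.chart.target χ) :
    ∃ C : ℝ, ∀ (t : ℝ) (ht : 0 < t) (u : L2 n F S μ), ‖c.mollifier μ hη hχ ht u‖ ≤ C * ‖u‖ := by
  obtain ⟨C, hC⟩ := c.exists_norm_mollifyLift_le μ hη
  refine ⟨C * ‖c.coordL2 μ hχ‖, fun t ht u => (hC t ht _).trans ?_⟩
  rw [mul_assoc]
  gcongr
  exact (c.coordL2 μ hχ).le_opNorm u

/-- On test sections the abstract extension is the explicit formula, pointwise: mollification does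
not see the choice of representative. -/
theorem mollifier_toL2_val (hη : IsTestFunction c.chart.target η)
    (hχ : IsTestFunction c.chart.target χ) {t : ℝ} (ht : 0 < t) (u : TestSections n F S μ) :
    (c.mollifier μ hη hχ ht (toL2 n F S μ u)).1 =
      c.lift fun x => η x • mollify (kernel _) t (fun y => χ y • c.coord u.1 y) x := by
  have h : (c.mollifier μ hη hχ ht (toL2 n F S μ u)).1 =
      c.lift fun x => η x • mollify (kernel _) t (c.coordL2 μ hχ (toL2 n F S μ u)) x := rfl
  have h' : c.coordLp μ hχ u =ᵐ[volume] fun y => χ y • c.coord u.1 y :=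
    (c.memLp_smul_coord hχ u.2.1).coeFn_toLp
  rw [h, coordL2_toL2, mollify_congr_ae _ ht h']

/-- The limit is ηχu. The sup norm rate `C * t` becomes an `L²` rate because `η` lies in `L²`. -/
theorem exists_norm_mollifier_sub_le (hη : IsTestFunction c.chart.target η)
    (hχ : IsTestFunction c.chart.target χ) (u v : TestSections n F S μ)
    (hv : v.1 = c.lift fun x => η x • χ x • c.coord u.1 x) :
    ∃ C : ℝ, ∀ (t : ℝ) (ht : 0 < t), ‖c.mollifier μ hη hχ ht (toL2 n F S μ u) - v‖ ≤ C * t := by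
  obtain ⟨C₁, hC₁⟩ := c.exists_enorm_lift_le μ hη.hasCompactSupport.isCompact hη.tsupport_subset
  have hh := c.isTestFunction_smul_coord hχ u.2.1
  have : CompleteSpace F := FiniteDimensional.complete ℂ F
  obtain ⟨C₂, hC₂⟩ := exists_norm_mollify_sub_le (contDiff_kernel (EuclideanSpace ℝ (Fin n)))
    (hasCompactSupport_kernel _) (integral_kernel _) hh.contDiff hh.hasCompactSupport
  have hηL : MemLp η 2 volume :=
    hη.contDiff.continuous.memLp_of_hasCompactSupport hη.hasCompactSupport
  refine ⟨C₁ * (C₂ * (eLpNorm η 2 volume).toReal), fun t ht => ?_⟩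
  set g : EuclideanSpace ℝ (Fin n) → F := fun x =>
    η x • (mollify (kernel _) t (fun y => χ y • c.coord u.1 y) x - χ x • c.coord u.1 x) with hg
  -- The sign of `C₂` is not given; the estimate at any point, here 0, supplies what
  -- `ENNReal.ofReal` needs.
  have hC₂t : 0 ≤ C₂ * t := (norm_nonneg _).trans (hC₂ t ht 0)
  have h1 := hC₁ g (c.mollifier μ hη hχ ht (toL2 n F S μ u) - v)
    (tsupport_smul_subset_left η _) (by
      change (c.mollifier μ hη hχ ht (toL2 n F S μ u)).1 - v.1 = _
      rw [mollifier_toL2_val, hv, sub_eq_iff_eq_add, ← lift_add]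
      congr 1
      ext x
      simp [hg, smul_sub])
  have h2 : eLpNorm g 2 volume ≤ ENNReal.ofReal (C₂ * t) * eLpNorm η 2 volume := by
    refine eLpNorm_le_mul_eLpNorm_of_ae_le_mul (.of_forall fun x => ?_) 2
    rw [hg, norm_smul, mul_comm]
    gcongr
    exact hC₂ t ht x
  have h3 := h1.trans (mul_le_mul_right h2 _)
  rw [← ofReal_norm, ← ENNReal.ofReal_toReal hηL.eLpNorm_ne_top, ← ENNReal.ofReal_mul hC₂t,
    ← ENNReal.ofReal_coe_nnreal, ← ENNReal.ofReal_mul C₁.coe_nonneg, ENNReal.ofReal_le_ofReal_iff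
      (mul_nonneg C₁.coe_nonneg (mul_nonneg hC₂t ENNReal.toReal_nonneg))] at h3
  refine h3.trans (le_of_eq ?_)
  ring

end BundleChart

end HermitianBundle

end

/-! ### Differential operators in a chart and their commutators with the local mollifier. -/

noncomputable section

namespace HermitianBundle

open Friedrichs NNReal

variable {n : ℕ} {M : Type*} [TopologicalSpace M]
  [ChartedSpace (EuclideanSpace ℝ (Fin n)) M]
  {F : Type*} [NormedAddCommGroup F] [NormedSpace ℂ F]
  {S : M → Type*} [TopologicalSpace (TotalSpace F S)]
  [∀ p, NormedAddCommGroup (S p)] [∀ p, InnerProductSpace ℂ (S p)]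
  [FiberBundle F S]

namespace BundleChart

variable (c : BundleChart n F S) [VectorBundle ℂ F S] [ContMDiffVectorBundle ∞ F S (𝓡 n)]
  [T2Space M] [IsManifold (𝓡 n) ∞ M] [FiniteDimensional ℂ F]

/-- In a chart, a differential operator agrees over a compact set with an operator whose
coefficients are smooth with compact support. -/
theorem exists_coefficients {D : smoothSections n F S →ₗ[ℂ] smoothSections n F S}
    (hD : IsDifferentialOperator D) {L : Set (EuclideanSpace ℝ (Fin n))} (hL : IsCompact L)
    (hLt : L ⊆ c.chart.target) :
    ∃ (a : Fin n → EuclideanSpace ℝ (Fin n) → F →L[ℝ] F)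
      (b : EuclideanSpace ℝ (Fin n) → F →L[ℝ] F),
      (∀ j, IsTestFunction c.chart.target (a j)) ∧ IsTestFunction c.chart.target b ∧
      ∀ (u : smoothSections n F S), ∀ x ∈ L, c.coord (D u).1 x =
        ∑ j, a j x (fderiv ℝ (c.coord u.1) x (EuclideanSpace.single j 1)) + b x (c.coord u.1 x) := by
  obtain ⟨A, B, hA, hB, hAB⟩ := hD.eq_in_chart c.chart c.chart_mem c.triv
    c.isSmoothTrivialization c.source_subset
  obtain ⟨θ, hθ, hθ1⟩ := exists_isTestFunction_one_nhds hL c.chart.open_target hLt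
  have hcoef : ∀ A : M → F →L[ℂ] F, ContMDiffOn (𝓡 n) 𝓘(ℝ, F →L[ℂ] F) ∞ A c.chart.source →
      IsTestFunction c.chart.target
        fun x => θ x • (A (c.chart.symm x)).restrictScalars ℝ := fun A hA => by
    refine hθ.smul c.chart.open_target ?_
    exact (ContinuousLinearMap.restrictScalarsL ℂ F F ℝ ℝ).contDiff.comp_contDiffOn
      (hA.comp (contMDiffOn_symm_of_mem_maximalAtlas c.chart_mem) c.chart.mapsTo_symm).contDiffOn
  refine ⟨fun j x => θ x • (A j (c.chart.symm x)).restrictScalars ℝ,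
    fun x => θ x • (B (c.chart.symm x)).restrictScalars ℝ, fun j => hcoef _ (hA j), hcoef _ hB,
    fun u x hx => ?_⟩
  have hp := c.chart.map_target (hLt hx)
  have h1 : θ x = 1 := (hθ1 x hx).self_of_nhds
  have h := hAB u _ hp
  simp only [symm_eq c hp] at h
  rw [← map_sum, ← map_add] at h
  rw [coord_eq c _ (hLt hx), h, ContinuousLinearEquiv.apply_symm_apply, c.chart.right_inv (hLt hx)]
  simp only [h1, one_smul]
  rfl

theorem fderiv_eq_zero_of_notMem_tsupport {E G : Type*} [NormedAddCommGroup E] [NormedSpace ℝ E]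
    [NormedAddCommGroup G] [NormedSpace ℝ G] {g : E → G} {x : E} (hx : x ∉ tsupport g) :
    fderiv ℝ g x = 0 :=
  image_eq_zero_of_notMem_tsupport fun h => hx (tsupport_fderiv_subset ℝ h)

variable [IsHermitian n F S]
  [MeasurableSpace M] [BorelSpace M] (μ : Measure M) [IsSmoothMeasure n μ]
  {η χ : EuclideanSpace ℝ (Fin n) → ℝ}

/-- The commutator of a differential operator with the mollification in a chart is bounded in the
`L²` norm, uniformly in the scale. -/
theorem exists_norm_commutator_le {D : smoothSections n F S →ₗ[ℂ] smoothSections n F S}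
    (hD : IsDifferentialOperator D) (hη : IsTestFunction c.chart.target η)
    (hχ : IsTestFunction c.chart.target χ) :
    ∃ C : ℝ, ∀ (t : ℝ) (ht : 0 < t) (u : TestSections n F S μ),
      ‖hD.onTest μ (c.mollifier μ hη hχ ht (toL2 n F S μ u))
        - c.mollifier μ hη hχ ht (toL2 n F S μ (hD.onTest μ u))‖ ≤ C * ‖u‖ := by
  have : CompleteSpace F := FiniteDimensional.complete ℂ F
  have hL : IsCompact (tsupport η ∪ tsupport χ) :=
    hη.hasCompactSupport.isCompact.union hχ.hasCompactSupport.isCompact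
  have hLt : tsupport η ∪ tsupport χ ⊆ c.chart.target :=
    union_subset hη.tsupport_subset hχ.tsupport_subset
  obtain ⟨a, b, ha, hb, hab⟩ := c.exists_coefficients hD hL hLt
  -- The cut-off coordinates `v` below are smooth on all of Euclidean space and agree with those of
  -- `u`, derivatives included, on the support of `χ`. So the Euclidean lemma applies to `v`.
  obtain ⟨θ, hθ, hθ1⟩ := exists_isTestFunction_one_nhds hL c.chart.open_target hLt
  have hk := contDiff_kernel (EuclideanSpace ℝ (Fin n))
  have hkc := hasCompactSupport_kernel (EuclideanSpace ℝ (Fin n))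
  choose Ca hCa using fun j => exists_enorm_commutator_le hk hkc (ha j).contDiff
    (ha j).hasCompactSupport hη.contDiff hη.hasCompactSupport hχ.contDiff hχ.hasCompactSupport
    (EuclideanSpace.single j 1)
  obtain ⟨Cb, hCb⟩ := exists_enorm_commutator_zero_le hk hkc hb.contDiff
    hb.hasCompactSupport hη.contDiff hη.hasCompactSupport hχ.contDiff hχ.hasCompactSupport
  obtain ⟨C₁, hC₁⟩ := exists_eLpNorm_le_of_enorm_le_average (F := F) hkc (∑ j, Ca j + Cb)
  obtain ⟨C₂, hC₂⟩ := c.exists_enorm_lift_le μ hη.hasCompactSupport.isCompact hη.tsupport_subset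
  obtain ⟨C₃, hC₃⟩ := c.exists_eLpNorm_smul_coord_le μ hθ
  refine ⟨(C₂ * (C₁ * C₃) : ℝ≥0), fun t ht u => ?_⟩
  set v : EuclideanSpace ℝ (Fin n) → F := fun x => θ x • c.coord u.1 x with hv
  have hvs : IsTestFunction c.chart.target v := c.isTestFunction_smul_coord hθ u.2.1
  have hvc : ∀ x ∈ tsupport χ, v =ᶠ[𝓝 x] c.coord u.1 := fun x hx => by
    filter_upwards [hθ1 x (Or.inr hx)] with y hy
    change θ y • c.coord u.1 y = _
    rw [hy, one_smul]
  have hχv : (fun y => χ y • c.coord u.1 y) = fun y => χ y • v y := by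
    ext y
    by_cases hy : y ∈ tsupport χ
    · rw [(hvc y hy).eq_of_nhds]
    · simp [image_eq_zero_of_notMem_tsupport hy]
  have hχDv : (fun y => χ y • c.coord (hD.onTest μ u).1 y) = fun y =>
      (∑ j, χ y • a j y (fderiv ℝ v y (EuclideanSpace.single j 1))) + χ y • b y (v y) := by
    ext y
    by_cases hy : y ∈ tsupport χ
    · have h := hab ⟨u.1, u.2.1⟩ y (Or.inr hy)
      rw [← Finset.smul_sum, ← smul_add, (hvc y hy).fderiv_eq, (hvc y hy).eq_of_nhds, ← h]
      rfl
    · simp [image_eq_zero_of_notMem_tsupport hy]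
  have hcv := hvs.contDiff.continuous
  have hcχ := hχ.contDiff.continuous
  have hcdv := hvs.contDiff.continuous_fderiv (by simp)
  have hli : ∀ j, LocallyIntegrable (fun y =>
      χ y • a j y (fderiv ℝ v y (EuclideanSpace.single j 1))) volume := fun j => by
    have := (ha j).contDiff.continuous
    exact Continuous.locallyIntegrable (by fun_prop)
  have hli' : LocallyIntegrable (fun y => χ y • b y (v y)) volume := by
    have := hb.contDiff.continuous
    exact Continuous.locallyIntegrable (by fun_prop)
  have hsum : LocallyIntegrable (fun y =>
      ∑ j, χ y • a j y (fderiv ℝ v y (EuclideanSpace.single j 1))) volume := by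
    have := fun j => (ha j).contDiff.continuous
    exact Continuous.locallyIntegrable (by fun_prop)
  set g : EuclideanSpace ℝ (Fin n) → F := fun x =>
    η x • mollify (kernel _) t (fun y => χ y • v y) x with hg
  have hgs : IsTestFunction c.chart.target g := c.isTestFunction_smul_mollify hη ht
    (Continuous.locallyIntegrable (by fun_prop))
  have hgη : tsupport g ⊆ tsupport η := tsupport_smul_subset_left η _
  -- The fibre coordinates of the commutator applied to `u`, grouped as one Friedrichs commutator
  -- per first order coefficient and one of order zero.
  set r : EuclideanSpace ℝ (Fin n) → F := fun x =>
    (∑ j, (a j x (fderiv ℝ g x (EuclideanSpace.single j 1)) - η x • mollify (kernel _) t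
      (fun y => χ y • a j y (fderiv ℝ v y (EuclideanSpace.single j 1))) x))
    + (b x (g x) - η x • mollify (kernel _) t (fun y => χ y • b y (v y)) x) with hr
  have hrη : tsupport r ⊆ tsupport η := by
    refine closure_minimal (fun x hx => ?_) (isClosed_tsupport η)
    by_contra h
    refine hx ?_
    have hgx : x ∉ tsupport g := fun h' => h (hgη h')
    simp [hr, fderiv_eq_zero_of_notMem_tsupport hgx, image_eq_zero_of_notMem_tsupport h,
      image_eq_zero_of_notMem_tsupport hgx]
  have hmoll : ∀ x, mollify (kernel _) t (fun y => χ y • c.coord (hD.onTest μ u).1 y) x =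
      (∑ j, mollify (kernel _) t
        (fun y => χ y • a j y (fderiv ℝ v y (EuclideanSpace.single j 1))) x)
      + mollify (kernel _) t (fun y => χ y • b y (v y)) x := fun x => by
    rw [hχDv, ← mollify_sum _ hk.continuous hkc ht fun j _ => hli j]
    exact congrFun (mollify_add hk.continuous hkc ht hsum hli') x
  set w := c.mollifier μ hη hχ ht (toL2 n F S μ u) with hw
  have hwg : w.1 = c.lift g := by
    rw [hw, mollifier_toL2_val, hχv]
  have hr1 : (hD.onTest μ w - c.mollifier μ hη hχ ht (toL2 n F S μ (hD.onTest μ u))).1 =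
      c.lift r := by
    change (hD.onTest μ w).1 - (c.mollifier μ hη hχ ht (toL2 n F S μ (hD.onTest μ u))).1 = _
    rw [mollifier_toL2_val, sub_eq_iff_eq_add, ← lift_add]
    have hrg : (r + fun x => η x • mollify (kernel _) t
        (fun y => χ y • c.coord (hD.onTest μ u).1 y) x) = fun x =>
        (∑ j, a j x (fderiv ℝ g x (EuclideanSpace.single j 1))) + b x (g x) := by
      ext x
      simp only [Pi.add_apply, hmoll, hr, smul_add, Finset.smul_sum, Finset.sum_sub_distrib]
      abel
    rw [hrg]
    have hsupp : sectionSupport (hD.onTest μ w).1 ⊆ c.chart.symm '' tsupport η :=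
      (hD.sectionSupport_subset ⟨w.1, w.2.1⟩).trans (by
        change sectionSupport w.1 ⊆ _
        rw [hwg]
        exact (c.sectionSupport_lift_subset hgs).trans (image_mono hgη))
    ext p
    -- Over the support of `η` the coordinate formula for `D` is available; elsewhere both sides
    -- vanish by locality.
    by_cases hp : p ∈ c.chart.symm '' tsupport η
    · obtain ⟨x, hx, rfl⟩ := hp
      have hxt := hη.tsupport_subset hx
      have hps := c.chart.map_target hxt
      have h := hab ⟨w.1, w.2.1⟩ x (Or.inl hx)
      have hco : c.coord w.1 =ᶠ[𝓝 x] g := by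
        filter_upwards [c.chart.open_target.mem_nhds hxt] with y hy
        rw [hwg, coord_lift c hy]
      rw [hco.fderiv_eq, hco.eq_of_nhds] at h
      rw [lift_of_mem c hps, c.chart.right_inv hxt, ← h]
      have h' := c.symm_coord (hD.onTest μ w).1 hps
      rw [c.chart.right_inv hxt] at h'
      exact h'.symm
    · have h0 : (hD.onTest μ w).1 p = 0 := by
        by_contra h
        exact hp (hsupp (subset_closure h))
      rw [h0]
      by_cases hps : p ∈ c.chart.source
      · have hx : c.chart p ∉ tsupport g := fun h => hp ⟨_, hgη h, c.chart.left_inv hps⟩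
        rw [lift_of_mem c hps, fderiv_eq_zero_of_notMem_tsupport hx,
          image_eq_zero_of_notMem_tsupport hx]
        simp only [_root_.zero_apply, map_zero, Finset.sum_const_zero, add_zero]
        rw [symm_eq c hps, map_zero]
      · rw [lift_of_notMem c hps]
  have hbound : ∀ x, ‖r x‖ₑ ≤ (∑ j, Ca j + Cb : ℝ≥0) * average (kernel _) t v x := fun x => by
    refine (enorm_add_le _ _).trans ?_
    push_cast
    rw [add_mul, Finset.sum_mul]
    exact add_le_add ((enorm_sum_le _ _).trans
      (Finset.sum_le_sum fun j _ => hCa j t ht v hvs.contDiff x)) (hCb t v x)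
  have h1 := hC₂ r _ hrη hr1
  have h2 := hC₁ t v r hcv.stronglyMeasurable hbound
  have h3 : ‖hD.onTest μ w - c.mollifier μ hη hχ ht (toL2 n F S μ (hD.onTest μ u))‖ₑ ≤
      (C₂ * (C₁ * C₃) : ℝ≥0) * ‖u‖ₑ := by
    refine h1.trans ?_
    push_cast
    rw [mul_assoc, mul_assoc]
    gcongr
    refine h2.trans ?_
    gcongr
    exact hC₃ u
  have h4 : ‖hD.onTest μ w - c.mollifier μ hη hχ ht (toL2 n F S μ (hD.onTest μ u))‖₊ ≤
      (C₂ * (C₁ * C₃)) * ‖u‖₊ := by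
    simp only [enorm_eq_nnnorm] at h3
    exact_mod_cast h3
  exact h4

end BundleChart

end HermitianBundle

end

/-! ### Gluing the local mollifiers over `K`. -/

noncomputable section

namespace HermitianBundle

open Friedrichs NNReal

section Global

variable {n : ℕ} {M : Type*} [TopologicalSpace M]
  [ChartedSpace (EuclideanSpace ℝ (Fin n)) M]
  {F : Type*} [NormedAddCommGroup F] [NormedSpace ℂ F]
  {S : M → Type*} [TopologicalSpace (TotalSpace F S)]
  [∀ p, NormedAddCommGroup (S p)] [∀ p, InnerProductSpace ℂ (S p)]
  [FiberBundle F S]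

namespace BundleChart

/-- Take `η` equal to one near the support of `f`, and `χ` equal to η f in the chart. Two factors
are needed because one acts before the mollification and the other after it. -/
theorem exists_isTestFunction_eq (c : BundleChart n F S) {f : M → ℝ}
    (hf : ContMDiff (𝓡 n) 𝓘(ℝ, ℝ) ∞ f) (hfc : HasCompactSupport f)
    (hfs : tsupport f ⊆ c.chart.source) :
    ∃ η χ : EuclideanSpace ℝ (Fin n) → ℝ, IsTestFunction c.chart.target η ∧
      IsTestFunction c.chart.target χ ∧
      ∀ p ∈ c.chart.source, η (c.chart p) * χ (c.chart p) = f p := by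
  have hL : IsCompact (c.chart '' tsupport f) :=
    hfc.isCompact.image_of_continuousOn (c.chart.continuousOn.mono hfs)
  have hLt : c.chart '' tsupport f ⊆ c.chart.target := by
    rintro _ ⟨p, hp, rfl⟩
    exact c.chart.map_source (hfs hp)
  obtain ⟨θ, hθ, hθ1⟩ := exists_isTestFunction_one_nhds hL c.chart.open_target hLt
  refine ⟨θ, fun x => θ x • f (c.chart.symm x), hθ, hθ.smul c.chart.open_target
    (hf.comp_contMDiffOn (contMDiffOn_symm_of_mem_maximalAtlas c.chart_mem)).contDiffOn,
    fun p hp => ?_⟩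
  simp only [c.chart.left_inv hp]
  by_cases hpf : p ∈ tsupport f
  · rw [(hθ1 _ (mem_image_of_mem _ hpf)).self_of_nhds, one_smul, one_mul]
  · simp [image_eq_zero_of_notMem_tsupport hpf]

open Classical in
variable (n F S) in
theorem exists_cutoffs [T2Space M] [SecondCountableTopology M] [IsManifold (𝓡 n) ∞ M]
    {K : Set M} (hK : IsCompact K) :
    ∃ (s : Finset M) (c : s → BundleChart n F S) (η χ : s → EuclideanSpace ℝ (Fin n) → ℝ),
      (∀ i, IsTestFunction (c i).chart.target (η i)) ∧
      (∀ i, IsTestFunction (c i).chart.target (χ i)) ∧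
      ∀ p ∈ K, ∑ i, (if p ∈ (c i).chart.source then
        η i ((c i).chart p) * χ i ((c i).chart p) else 0) = 1 := by
  have : LocallyCompactSpace M := ChartedSpace.locallyCompactSpace (EuclideanSpace ℝ (Fin n)) M
  choose c hc using exists_mem_source (n := n) F S (M := M)
  -- Subordinating the partition to interiors of compact sets gives its members compact support
  -- inside the chart domains.
  choose L hL hpL hLc using fun p => exists_compact_subset (c p).chart.open_source (hc p)
  obtain ⟨s, -, hs⟩ := hK.elim_nhds_subcover (fun p => interior (L p))
    fun p _ => isOpen_interior.mem_nhds (hpL p)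
  obtain ⟨f, hf⟩ := SmoothPartitionOfUnity.exists_isSubordinate (𝓡 n) hK.isClosed
    (fun i : s => interior (L i)) (fun _ => isOpen_interior) (hs.trans
      (iUnion₂_subset fun i hi => subset_iUnion (fun i : s => interior (L i)) ⟨i, hi⟩))
  have hfL : ∀ i : s, tsupport (f i) ⊆ L i := fun i => (hf i).trans interior_subset
  choose η χ hη hχ hηχ using fun i : s => (c i).exists_isTestFunction_eq (f i).contMDiff
    ((hL i).of_isClosed_subset (isClosed_tsupport _) (hfL i)) ((hfL i).trans (hLc i))
  refine ⟨s, fun i => c i, η, χ, hη, hχ, fun p hp => ?_⟩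
  rw [← f.sum_eq_one hp, finsum_eq_sum_of_fintype]
  refine Finset.sum_congr rfl fun i _ => ?_
  split_ifs with h
  · exact hηχ i p h
  · exact (image_eq_zero_of_notMem_tsupport fun h' => h (hLc i (hfL i h'))).symm

end BundleChart

variable [VectorBundle ℂ F S] [ContMDiffVectorBundle ∞ F S (𝓡 n)]
  [T2Space M] [IsManifold (𝓡 n) ∞ M] [IsHermitian n F S] [FiniteDimensional ℂ F]
  [MeasurableSpace M] [BorelSpace M] (μ : Measure M) [IsSmoothMeasure n μ]

/-- A differential operator as a linear map on the smooth compactly supported sections. -/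
def IsDifferentialOperator.onTestLinear {D : smoothSections n F S →ₗ[ℂ] smoothSections n F S}
    (hD : IsDifferentialOperator D) : TestSections n F S μ →ₗ[ℂ] TestSections n F S μ where
  toFun := hD.onTest μ
  map_add' u v := Subtype.ext (congrArg (fun w : smoothSections n F S => w.1)
    (D.map_add ⟨u.1, u.2.1⟩ ⟨v.1, v.2.1⟩))
  map_smul' a u := Subtype.ext (congrArg (fun w : smoothSections n F S => w.1)
    (D.map_smul a ⟨u.1, u.2.1⟩))

/-- Smoothing operators which approximate the identity on the sections supported in `K`, and whose
commutators with differential operators are bounded. -/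
theorem exists_mollifiers [SecondCountableTopology M] {K : Set M} (hK : IsCompact K) :
    ∃ T : ∀ t : ℝ, 0 < t → L2 n F S μ →ₗ[ℂ] TestSections n F S μ,
      (∃ C : ℝ, ∀ t ht u, ‖T t ht u‖ ≤ C * ‖u‖) ∧
      (∀ u : testSectionsOn n F S μ K, ∃ C : ℝ, ∀ t ht, ‖T t ht (toL2 n F S μ u.1) - u‖ ≤ C * t) ∧
      ∀ (D : smoothSections n F S →ₗ[ℂ] smoothSections n F S) (hD : IsDifferentialOperator D),
        ∃ C : ℝ, ∀ t ht u, ‖hD.onTest μ (T t ht (toL2 n F S μ u))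
          - T t ht (toL2 n F S μ (hD.onTest μ u))‖ ≤ C * ‖u‖ := by
  classical
  obtain ⟨s, c, η, χ, hη, hχ, hsum⟩ := BundleChart.exists_cutoffs n F S hK
  refine ⟨fun t ht => ∑ i, (c i).mollifier μ (hη i) (hχ i) ht, ?_, fun u => ?_, fun D hD => ?_⟩
  · choose C hC using fun i => (c i).exists_norm_mollifier_le μ (hη i) (hχ i)
    refine ⟨∑ i, C i, fun t ht u => ?_⟩
    rw [LinearMap.sum_apply, Finset.sum_mul]
    exact norm_sum_le_of_le _ fun i _ => hC i t ht u
  · set v : s → TestSections n F S μ := fun i => (c i).liftTest μ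
      ⟨fun x => η i x • χ i x • (c i).coord u.1.1 x,
        (hη i).smul (c i).chart.open_target
          ((c i).isTestFunction_smul_coord (hχ i) u.1.2.1).contDiff.contDiffOn⟩ with hv
    -- The limits of the local pieces are f_i u. They sum to `u`: the partition sums to one on `K`,
    -- and `u` vanishes off `K`.
    have hvu : ∑ i, v i = u.1 := by
      let ev : ∀ p, TestSections n F S μ →+ S p := fun p =>
        { toFun := fun w => w.1 p, map_zero' := rfl, map_add' := fun _ _ => rfl }
      refine Subtype.ext (funext fun p => ?_)
      change ev p (∑ i, v i) = u.1.1 p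
      rw [map_sum]
      have hvp : ∀ i, ev p (v i) = (if p ∈ (c i).chart.source then
          η i ((c i).chart p) * χ i ((c i).chart p) else 0) • u.1.1 p := fun i => by
        change (c i).lift (fun x => η i x • χ i x • (c i).coord u.1.1 x) p = _
        split_ifs with h
        · rw [(c i).lift_of_mem h, smul_smul, ← (c i).symm_coord u.1.1 h,
            -- The trivialization is complex linear, so the real cutoff is turned into a complex
            -- scalar to pass through it.
            (c i).symm_eq h, (c i).symm_eq h, ← Complex.coe_smul, ← Complex.coe_smul, map_smul]
        · rw [(c i).lift_of_notMem h, zero_smul]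
      rw [Finset.sum_congr rfl fun i _ => hvp i, ← Finset.sum_smul]
      by_cases hp : p ∈ K
      · rw [hsum p hp, one_smul]
      · have : u.1.1 p = 0 := by
          by_contra h
          exact hp (u.2 (subset_closure h))
        rw [this, smul_zero]
    choose C hC using fun i => (c i).exists_norm_mollifier_sub_le μ (hη i) (hχ i) u.1 (v i) rfl
    refine ⟨∑ i, C i, fun t ht => ?_⟩
    rw [LinearMap.sum_apply, ← hvu, ← Finset.sum_sub_distrib, Finset.sum_mul, hvu]
    exact norm_sum_le_of_le _ fun i _ => hC i t ht
  · choose C hC using fun i => (c i).exists_norm_commutator_le μ hD (hη i) (hχ i)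
    refine ⟨∑ i, C i, fun t ht u => ?_⟩
    change ‖hD.onTestLinear μ _ - _‖ ≤ _
    rw [LinearMap.sum_apply, LinearMap.sum_apply, map_sum, ← Finset.sum_sub_distrib,
      Finset.sum_mul]
    exact norm_sum_le_of_le _ fun i _ => hC i t ht u

/-- `toL2On` as a linear map. -/
def toL2OnLinear (K : Set M) : testSectionsOn n F S μ K →ₗ[ℂ] L2On n F S μ K where
  toFun := toL2On n F S μ K
  map_add' u v := Subtype.ext ((toL2 n F S μ).map_add u.1 v.1)
  map_smul' a u := Subtype.ext ((toL2 n F S μ).map_smul a u.1)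

theorem denseRange_toL2OnLinear (K : Set M) :
    DenseRange (toL2OnLinear (n := n) (F := F) (S := S) μ K) := by
  rw [Metric.denseRange_iff]
  intro x r hr
  obtain ⟨_, ⟨u, hu, rfl⟩, h⟩ := Metric.mem_closure_iff.1 x.2 r hr
  exact ⟨⟨u, hu⟩, h⟩

end Global

end HermitianBundle

end

/-! ### The main theorem. -/

open HermitianBundle
theorem mainTheorem8 (n : ℕ)
    {M : Type*} [TopologicalSpace M] [T2Space M] [SecondCountableTopology M]
    [ChartedSpace (EuclideanSpace ℝ (Fin n)) M] [IsManifold (𝓡 n) ∞ M]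
    [MeasurableSpace M] [BorelSpace M]
    (F : Type*) [NormedAddCommGroup F] [NormedSpace ℂ F] [FiniteDimensional ℂ F]
    (S : M → Type*) [TopologicalSpace (TotalSpace F S)]
    [∀ p, NormedAddCommGroup (S p)] [∀ p, InnerProductSpace ℂ (S p)]
    [FiberBundle F S] [VectorBundle ℂ F S] [ContMDiffVectorBundle ∞ F S (𝓡 n)]
    [IsHermitian n F S]
    (μ : Measure M) [IsSmoothMeasure n μ]
    (K : Set M) (hK : IsCompact K) :
    ∃ ε : ℝ, 0 < ε ∧ ∃ T : ℝ → L2On n F S μ K →L[ℂ] L2 n F S μ,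
      (∃ C : ℝ, ∀ t ∈ Ioo 0 ε, ‖T t‖ ≤ C) ∧
      (∀ u : L2On n F S μ K, Tendsto (fun t => T t u) (𝓝[>] 0) (𝓝 (u : L2 n F S μ))) ∧
      (∀ t ∈ Ioo 0 ε, ∀ u : L2On n F S μ K, ∃ v : TestSections n F S μ,
        T t u = toL2 n F S μ v) ∧
      (∀ (D : smoothSections n F S →ₗ[ℂ] smoothSections n F S) (hD : IsDifferentialOperator D),
        ∃ C : ℝ, ∀ t ∈ Ioo 0 ε, ∃ B : L2On n F S μ K →L[ℂ] L2 n F S μ,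
          ExtendsCommutator μ hD K (T t) B ∧ ‖B‖ ≤ C) := by
  classical
  obtain ⟨G, ⟨C, hC⟩, hlim, hcomm⟩ := exists_mollifiers (n := n) (F := F) (S := S) μ hK
  set P : ∀ t : ℝ, 0 < t → L2On n F S μ K →L[ℂ] L2 n F S μ := fun t ht =>
    ((toL2 n F S μ).toLinearMap ∘ₗ G t ht).mkContinuous C
      (fun u => ((toL2 n F S μ).norm_map _).le.trans (hC t ht u)) ∘L (L2On n F S μ K).subtypeL
  have hP : ∀ t ht u, P t ht u = toL2 n F S μ (G t ht u) := fun _ _ _ => rfl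
  have hPC : ∀ t ht u, ‖P t ht u‖ ≤ max C 0 * ‖u‖ := fun t ht u => by
    rw [hP, LinearIsometry.norm_map]
    exact (hC t ht u).trans (mul_le_mul_of_nonneg_right (le_max_left _ _) (norm_nonneg _))
  set T : ℝ → L2On n F S μ K →L[ℂ] L2 n F S μ := fun t => if ht : 0 < t then P t ht else 0
  have hT : ∀ t (ht : 0 < t), T t = P t ht := fun t ht => dif_pos ht
  refine ⟨1, one_pos, T, ⟨max C 0, fun t ht => ?_⟩, fun u => ?_, fun t ht u => ?_, fun D hD => ?_⟩
  · rw [hT t ht.1]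
    exact ContinuousLinearMap.opNorm_le_bound _ (le_max_right _ _) (hPC t ht.1)
  · rw [Metric.tendsto_nhds]
    intro ε hε
    have hC' : 0 < max C 0 + 1 := by positivity
    -- Approximating `u` by a smooth `w` costs `max C 0` times the distance through the operator and
    -- once more in the limit. The radius makes this total less than ε/2, leaving ε/2 for the term
    -- C' t.
    obtain ⟨w, hw⟩ := Metric.denseRange_iff.1 (denseRange_toL2OnLinear μ K) u
      (ε / (2 * (max C 0 + 1))) (by positivity)
    obtain ⟨C', hC'w⟩ := hlim w
    have h0 : Tendsto (fun t : ℝ => C' * t) (𝓝[>] 0) (𝓝 0) := by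
      have : Tendsto (fun t : ℝ => C' * t) (𝓝 0) (𝓝 (C' * 0)) :=
        (continuous_const.mul continuous_id).tendsto 0
      rw [mul_zero] at this
      exact this.mono_left nhdsWithin_le_nhds
    filter_upwards [self_mem_nhdsWithin, h0.eventually (gt_mem_nhds (half_pos hε))] with t ht hts
    rw [hT t ht]
    have h1 : ‖P t ht (u - toL2OnLinear μ K w)‖ ≤ max C 0 * ‖u - toL2OnLinear μ K w‖ := hPC t ht _
    have h2 : ‖P t ht (toL2OnLinear μ K w) - (toL2OnLinear μ K w : L2 n F S μ)‖ ≤ C' * t := by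
      change ‖toL2 n F S μ (G t ht (toL2 n F S μ w.1)) - toL2 n F S μ w.1‖ ≤ _
      rw [← map_sub, LinearIsometry.norm_map]
      exact hC'w t ht
    have h3 : ‖(toL2OnLinear μ K w : L2 n F S μ) - u‖ = ‖u - toL2OnLinear μ K w‖ := by
      rw [norm_sub_rev]
      rfl
    rw [dist_eq_norm] at hw ⊢
    have h4 : P t ht u - (u : L2 n F S μ) = P t ht (u - toL2OnLinear μ K w)
        + (P t ht (toL2OnLinear μ K w) - (toL2OnLinear μ K w : L2 n F S μ))
        + ((toL2OnLinear μ K w : L2 n F S μ) - u) := by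
      rw [map_sub]
      abel
    have h5 : (max C 0 + 1) * ‖u - toL2OnLinear μ K w‖ < ε / 2 := by
      rw [lt_div_iff₀ (by positivity)] at hw
      linarith
    calc ‖P t ht u - (u : L2 n F S μ)‖ ≤ _ := h4 ▸ norm_add₃_le
      _ ≤ max C 0 * ‖u - toL2OnLinear μ K w‖ + C' * t + ‖u - toL2OnLinear μ K w‖ := by
        rw [h3]
        gcongr
      _ < ε := by linarith
  · exact ⟨G t ht.1 u, by rw [hT t ht.1, hP]⟩
  · obtain ⟨C', hC'⟩ := hcomm D hD
    refine ⟨max C' 0, fun t ht => ?_⟩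
    -- The commutator as a linear map on the dense subspace of smooth sections; its bound in the
    -- `L²` norm lets it extend to `L²(K; S)`.
    obtain ⟨L, hLu⟩ : ∃ L : testSectionsOn n F S μ K →ₗ[ℂ] L2 n F S μ, ∀ u, L u =
        toL2 n F S μ (hD.onTest μ (G t ht.1 (toL2 n F S μ u.1))
          - G t ht.1 (toL2 n F S μ (hD.onTest μ u.1))) :=
      ⟨(toL2 n F S μ).toLinearMap ∘ₗ
        (hD.onTestLinear μ ∘ₗ G t ht.1 ∘ₗ (toL2 n F S μ).toLinearMap
          - G t ht.1 ∘ₗ (toL2 n F S μ).toLinearMap ∘ₗ hD.onTestLinear μ) ∘ₗ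
        (testSectionsOn n F S μ K).subtype, fun _ => rfl⟩
    have hL : ∀ u, ‖L u‖ ≤ max C' 0 * ‖toL2OnLinear μ K u‖ := fun u => by
      have h1 : ‖toL2OnLinear μ K u‖ = ‖u.1‖ := (toL2 n F S μ).norm_map u.1
      rw [h1, hLu, LinearIsometry.norm_map]
      refine (hC' t ht.1 u.1).trans ?_
      exact mul_le_mul_of_nonneg_right (le_max_left _ _) (norm_nonneg _)
    have hd := denseRange_toL2OnLinear (n := n) (F := F) (S := S) μ K
    refine ⟨L.extendOfNorm (toL2OnLinear μ K), fun u => ?_,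
      LinearMap.opNorm_extendOfNorm_le hd (le_max_right _ _) hL⟩
    refine ⟨G t ht.1 (toL2 n F S μ u.1), by rw [hT t ht.1]; rfl, ?_⟩
    have h1 : L.extendOfNorm (toL2OnLinear μ K) (toL2On n F S μ K u) = L u :=
      LinearMap.extendOfNorm_eq hd ⟨_, hL⟩ u
    rw [hT t ht.1, h1, hLu, map_sub]
    rfl
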